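/- Let $N\ge 3$. Write $|\vec 0\rangle=|0\rangle^{\otimes N}$ and let $|\vec i\rangle$ be the $N$-qubit basis vector with a $1$ at party $i$ and $0$ elsewhere; $|W_N\rangle=N^{-1/2}\sum_{i=1}^N|\vec i\rangle$. A unit vector is a W-class state if it equals $(A_1\otimes\cdots\otimes A_N)|W_N\rangle$ for invertible operators $A_i$. Such a state equals, up to local unitaries, $\sqrt{x_0}\,|\vec 0\rangle+\sum_{i=1}^N\sqrt{x_i}\,|\vec i\rangle$ with $x_i\ge 0$, $x_0=1-\sum_{i=1}^N x_i\ge 0$, and is then denoted $|\vec x\rangle$. An LOCC protocol is a finite tree of rounds; in each round one party measures its qubit (finitely many Kraus operators $M_j$ with $\sum_j M_j^\dagger M_j=I$) and announces the outcome, on which the rest of the protocol may depend. It converts $|\vec x\rangle$ into $|\vec y\rangle$ with probability $p$ if $p$ is the total probability of the branches whose final state is $|\vec y\rangle$ (up to a phase). Let $|\vec x\rangle$, $|\vec y\rangle$ be W-class states, $r_i=x_i/y_i$ for $0\le i\le N$ (with $r_0=\infty$ if $y_0=0<x_0$ and $r_0=0$ if $x_0=y_0=0$), and let the parties be labelled so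 that $r_1\le r_2\le\cdots\le r_N$. Then no LOCC protocol converts $|\vec x\rangle$ into $|\vec y\rangle$ with probability larger than $\min\{1,r_1\}$, and the maximal probability of conversion by LOCC protocols exists and equals $\min\{1,r_1\}$ (that is, $r_1$ when $r_1\le 1$) if and only if $r_2\ge r_0$. -/

import Mathlib

open scoped Matrix ENNReal

noncomputable section

/-- The state space of `N` qubits, `(ℂ²)^{⊗N}`, in the computational basis; a basis vector is
labelled by the bit string `b : Fin N → Fin 2`. -/
abbrev QubitSpace (N : ℕ) := EuclideanSpace ℂ (Fin N → Fin 2)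

/-- An operator on one qubit. -/
abbrev QubitOp := Matrix (Fin 2) (Fin 2) ℂ

namespace QubitSpace

variable {N : ℕ}

/-- The basis vector `|00⋯0⟩`. -/
def ketZero (N : ℕ) : QubitSpace N := EuclideanSpace.single 0 1

/-- The basis vector with a `1` at party `i` and `0` elsewhere. -/
def ketOne (i : Fin N) : QubitSpace N := EuclideanSpace.single (Pi.single i 1) 1

/-- `M` acting on the qubit of party `k`, the identity on all other qubits. -/
def applyAt (k : Fin N) (M : QubitOp) (ψ : QubitSpace N) : QubitSpace N :=
  WithLp.toLp 2 fun b => ∑ c : Fin 2, M (b k) c * ψ (Function.update b k c)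

/-- `A₁ ⊗ ⋯ ⊗ A_N` acting on `ψ`. -/
def applyAll (A : Fin N → QubitOp) (ψ : QubitSpace N) : QubitSpace N :=
  WithLp.toLp 2 fun b => ∑ c : Fin N → Fin 2, (∏ i, A i (b i) (c i)) * ψ c

/-- The `N`-party W state `N^{-1/2} ∑ᵢ |i⟩`. -/
def stateW (N : ℕ) : QubitSpace N := ∑ i : Fin N, (((1 / √(N : ℝ) : ℝ)) : ℂ) • ketOne i

/-- A (normalized) W-class state: the image of the W state under invertible local operators. -/
def IsWClass (Ψ : QubitSpace N) : Prop :=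
  ‖Ψ‖ = 1 ∧ ∃ A : Fin N → QubitOp, (∀ i, IsUnit (A i)) ∧ Ψ = applyAll A (stateW N)

/-- The coefficient `x₀ = 1 - ∑ᵢ xᵢ` belonging to `(x₁, …, x_N)`. -/
def coeffZero (x : Fin N → ℝ) : ℝ := 1 - ∑ i, x i

/-- The vector `√x₀ |00⋯0⟩ + ∑ᵢ √xᵢ |i⟩`. -/
def canonicalState (x : Fin N → ℝ) : QubitSpace N :=
  ((√(coeffZero x) : ℝ) : ℂ) • ketZero N + ∑ i, ((√(x i) : ℝ) : ℂ) • ketOne i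

/-- `x` is a coefficient vector of `Ψ`: up to local unitaries, `Ψ` is
`√x₀ |00⋯0⟩ + ∑ᵢ √xᵢ |i⟩` with `x₀, x₁, …, x_N ≥ 0`. -/
def IsCoeffVector (Ψ : QubitSpace N) (x : Fin N → ℝ) : Prop :=
  (∀ i, 0 ≤ x i) ∧ 0 ≤ coeffZero x ∧
    ∃ U : Fin N → QubitOp, (∀ i, U i ∈ Matrix.unitaryGroup (Fin 2) ℂ) ∧
      Ψ = applyAll U (canonicalState x)

end QubitSpace

/-- An LOCC protocol with finitely many rounds on `N` qubits, as a tree. Either it stops, or some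
party `k` performs a local measurement with finitely many outcomes, given by Kraus operators
`M j` with `∑ⱼ (M j)ᴴ (M j) = 1`, announces the outcome `j`, and the parties continue with the
protocol `next j`. A local unitary is a measurement with a single outcome. -/
inductive LOCCProtocol (N : ℕ) : Type
  | halt : LOCCProtocol N
  | measure (k : Fin N) (m : ℕ) (M : Fin m → QubitOp) (hM : ∑ j, (M j)ᴴ * M j = 1)
      (next : Fin m → LOCCProtocol N) : LOCCProtocol N

namespace LOCCProtocol

variable {N : ℕ}

open Classical in
/-- The total probability of the branches that end in the target state `Φ` (up to a scalar), when
the protocol starts in `ψ`. States along the branches are not renormalized, so that the squared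
norm at the end of a branch is the probability of that branch. -/
def successProb (Φ : QubitSpace N) : LOCCProtocol N → QubitSpace N → ℝ
  | halt, ψ => if ∃ c : ℂ, ψ = c • Φ then ‖ψ‖ ^ 2 else 0
  | measure k _ M _ next, ψ =>
      ∑ j, successProb Φ (next j) (QubitSpace.applyAt k (M j) ψ)

end LOCCProtocol

/-- The probabilities with which LOCC protocols convert `Ψ` into `Φ`. -/
def conversionProbs {N : ℕ} (Ψ Φ : QubitSpace N) : Set ℝ :=
  {p | ∃ P : LOCCProtocol N, P.successProb Φ Ψ = p}

/-- The ratio `r₀ = x₀ / y₀` in `[0, ∞]`; it is `∞` if `y₀ = 0 < x₀`, and `0` if `x₀ = 0`. -/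
def ratioZero {N : ℕ} (x y : Fin N → ℝ) : ℝ≥0∞ :=
  ENNReal.ofReal (QubitSpace.coeffZero x) / ENNReal.ofReal (QubitSpace.coeffZero y)

end

noncomputable section

/-! ### Local operators on the qubit space -/

namespace QubitSpace

variable {N : ℕ}

/-! Every state reached from a W-class state has the form `applyAll A (wSum N)`, and a measurement
by party `k` only multiplies `A k` on the left. Two kinds of quantities are read off from the Gram
matrices of the factors: `wCoeff A i`, the squared distance of the second column of `A i` from the
line of the first, times the squared norms of the other first columns; and `wCoeffZero A`, the
squared overlap with the normalized product of the first columns. For `N ≥ 3` they depend on the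
state alone and are its unnormalized coefficients (`wCoeff_of_applyAll_wSum_eq`).

Gram matrices add up over the outcomes of a measurement. Together with Cauchy–Schwarz this shows
that `wCoeff` does not increase on average (`sum_wCoeff_le`) and `wCoeffZero` does not decrease
(`wCoeffZero_le_sum`). The first fact gives `p * y i ≤ x i`, the upper bound. If it is attained for
party `i`, equality holds at every node; by the equality case of Cauchy–Schwarz a measurement by `i`
then rescales `wCoeffZero` and all other coefficients by the same factor. The inequality `x₀ * y l ≤
y₀ * x l`, an equality at successful leaves, thus propagates back to the root.

Conversely, the protocol reaches `q • y` with `q = min 1 r₁` (`achieves_sqrtVector_smul`). Lowering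
a party's coefficient can feed any fraction of the loss to `|00⋯0⟩`, which suffices if `x₀ ≤ q *
y₀`. If `x₀` is too large, the party of smallest ratio filters it down; the condition `r₀ ≤ r₂`
ensures that the other coefficients stay above their targets. -/

theorem applyAt_apply (k : Fin N) (M : QubitOp) (ψ : QubitSpace N) (b : Fin N → Fin 2) :
    applyAt k M ψ b = ∑ c : Fin 2, M (b k) c * ψ (Function.update b k c) := rfl

theorem applyAll_apply (A : Fin N → QubitOp) (ψ : QubitSpace N) (b : Fin N → Fin 2) :
    applyAll A ψ b = ∑ c : Fin N → Fin 2, (∏ i, A i (b i) (c i)) * ψ c := rfl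

theorem applyAll_smul (A : Fin N → QubitOp) (c : ℂ) (ψ : QubitSpace N) :
    applyAll A (c • ψ) = c • applyAll A ψ := by
  ext b
  simp [applyAll_apply, Finset.mul_sum, mul_left_comm]

theorem applyAt_smul (k : Fin N) (M : QubitOp) (c : ℂ) (ψ : QubitSpace N) :
    applyAt k M (c • ψ) = c • applyAt k M ψ := by
  ext b
  simp [applyAt_apply]
  ring

theorem applyAll_one (ψ : QubitSpace N) : applyAll (fun _ => 1) ψ = ψ := by
  ext b
  rw [applyAll_apply, Finset.sum_eq_single b]
  · simp
  · intro c _ hc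
    obtain ⟨i, hi⟩ := Function.ne_iff.1 hc
    rw [Finset.prod_eq_zero (Finset.mem_univ i), zero_mul]
    exact Matrix.one_apply_ne hi.symm
  · simp

theorem applyAll_applyAll (A B : Fin N → QubitOp) (ψ : QubitSpace N) :
    applyAll A (applyAll B ψ) = applyAll (fun i => A i * B i) ψ := by
  ext b
  simp only [applyAll_apply, Finset.mul_sum]
  rw [Finset.sum_comm]
  refine Finset.sum_congr rfl fun c _ => ?_
  simp only [Matrix.mul_apply]
  rw [Finset.prod_univ_sum, Fintype.piFinset_univ, Finset.sum_mul]
  refine Finset.sum_congr rfl fun d _ => ?_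
  rw [Finset.prod_mul_distrib]
  ring

theorem applyAt_eq_applyAll (k : Fin N) (M : QubitOp) (ψ : QubitSpace N) :
    applyAt k M ψ = applyAll (Function.update (fun _ => 1) k M) ψ := by
  ext b
  rw [applyAt_apply, applyAll_apply]
  rw [← Finset.sum_subset (Finset.subset_univ
    (Finset.univ.map ⟨fun c : Fin 2 => Function.update b k c, Function.update_injective b k⟩))]
  · rw [Finset.sum_map]
    refine Finset.sum_congr rfl fun c _ => ?_
    rw [← Finset.mul_prod_erase _ _ (Finset.mem_univ k), Finset.prod_eq_one]
    · simp
    · intro i hi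
      simp [Finset.ne_of_mem_erase hi]
  · intro c _ hc
    have : ∃ i, i ≠ k ∧ c i ≠ b i := by
      by_contra! h
      refine hc (Finset.mem_map.2 ⟨c k, Finset.mem_univ _, ?_⟩)
      ext i
      by_cases hi : i = k
      · subst hi; simp
      · simp [hi, h i hi]
    obtain ⟨i, hik, hi⟩ := this
    rw [Finset.prod_eq_zero (Finset.mem_univ i), zero_mul]
    simp only [Function.update_of_ne hik]
    exact Matrix.one_apply_ne hi.symm

/-- Local operators of different parties commute, so only one factor changes; this keeps all branch
states in product-operator form. -/
theorem applyAt_applyAll (k : Fin N) (M : QubitOp) (A : Fin N → QubitOp) (ψ : QubitSpace N) :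
    applyAt k M (applyAll A ψ) = applyAll (Function.update A k (M * A k)) ψ := by
  rw [applyAt_eq_applyAll, applyAll_applyAll]
  congr 1
  ext1 i
  by_cases hi : i = k
  · subst hi; simp
  · simp [hi]

open ComplexConjugate in
/-- A local measurement preserves the squared norm on average. -/
theorem sum_norm_sq_applyAt (k : Fin N) {m : ℕ} (M : Fin m → QubitOp)
    (hM : ∑ j, (M j)ᴴ * M j = 1) (ψ : QubitSpace N) :
    ∑ j, ‖applyAt k (M j) ψ‖ ^ 2 = ‖ψ‖ ^ 2 := by
  have key : ∀ u v : ℂ, ∑ j, (‖M j 0 0 * u + M j 0 1 * v‖ ^ 2 + ‖M j 1 0 * u + M j 1 1 * v‖ ^ 2)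
      = ‖u‖ ^ 2 + ‖v‖ ^ 2 := by
    intro u v
    have h (a b : Fin 2) := congrFun (congrFun hM a) b
    simp only [Matrix.sum_apply, Matrix.mul_apply, Fin.sum_univ_two,
      Matrix.conjTranspose_apply] at h
    have h00 := h 0 0
    have h01 := h 0 1
    have h10 := h 1 0
    have h11 := h 1 1
    simp only [Matrix.one_apply_eq, RCLike.star_def] at h00 h01 h10 h11
    rw [Matrix.one_apply_ne (by decide)] at h01 h10
    apply Complex.ofReal_injective
    push_cast
    simp only [← Complex.conj_mul', map_add, map_mul]
    calc _ = ∑ j, (conj u * u * (conj (M j 0 0) * M j 0 0 + conj (M j 1 0) * M j 1 0)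
          + conj u * v * (conj (M j 0 0) * M j 0 1 + conj (M j 1 0) * M j 1 1)
          + conj v * u * (conj (M j 0 1) * M j 0 0 + conj (M j 1 1) * M j 1 0)
          + conj v * v * (conj (M j 0 1) * M j 0 1 + conj (M j 1 1) * M j 1 1)) :=
          Finset.sum_congr rfl fun j _ => by ring
      _ = _ := by
          rw [Finset.sum_add_distrib, Finset.sum_add_distrib, Finset.sum_add_distrib,
            ← Finset.mul_sum, ← Finset.mul_sum, ← Finset.mul_sum, ← Finset.mul_sum,
            h00, h01, h10, h11]
          ring
  -- Separating the bit of party `k` from the others reduces the claim to the one-qubit identity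
  -- `key` for each choice of the remaining bits.
  have split : ∀ f : (Fin N → Fin 2) → ℝ, ∑ b, f b =
      ∑ g : {j // j ≠ k} → Fin 2, (f ((Equiv.funSplitAt k (Fin 2)).symm (0, g)) +
        f ((Equiv.funSplitAt k (Fin 2)).symm (1, g))) := by
    intro f
    rw [← (Equiv.funSplitAt k (Fin 2)).symm.sum_comp, Fintype.sum_prod_type_right]
    simp [Fin.sum_univ_two]
  have upd : ∀ (a c : Fin 2) (g : {j // j ≠ k} → Fin 2),
      Function.update ((Equiv.funSplitAt k (Fin 2)).symm (a, g)) k c =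
        (Equiv.funSplitAt k (Fin 2)).symm (c, g) := by
    intro a c g
    ext i
    by_cases hi : i = k
    · subst hi; simp
    · simp [hi]
  have val : ∀ (a : Fin 2) (g : {j // j ≠ k} → Fin 2),
      (Equiv.funSplitAt k (Fin 2)).symm (a, g) k = a := by
    intro a g; simp
  simp only [EuclideanSpace.norm_sq_eq, split, applyAt_apply, upd, val, Fin.sum_univ_two]
  rw [Finset.sum_comm]
  exact Finset.sum_congr rfl fun g _ => key _ _

/-! ### Vectors supported on bit strings of weight at most one -/

/-- The vector `c₀ |00⋯0⟩ + ∑ᵢ cᵢ |i⟩`. -/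
def wVector (c₀ : ℂ) (c : Fin N → ℂ) : QubitSpace N := c₀ • ketZero N + ∑ i, c i • ketOne i

theorem wVector_apply (c₀ : ℂ) (c : Fin N → ℂ) (b : Fin N → Fin 2) :
    wVector c₀ c b = (if b = 0 then c₀ else 0) + ∑ i, if b = Pi.single i 1 then c i else 0 := by
  simp [wVector, ketZero, ketOne, Pi.single_apply]

theorem canonicalState_eq_wVector (x : Fin N → ℝ) :
    canonicalState x = wVector ((√(coeffZero x) : ℝ) : ℂ) fun i => ((√(x i) : ℝ) : ℂ) := rfl

theorem stateW_eq_wVector : stateW N = wVector 0 fun _ => (((1 / √(N : ℝ) : ℝ)) : ℂ) := by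
  simp [wVector, stateW]

theorem wVector_zero (c₀ : ℂ) (c : Fin N → ℂ) : wVector c₀ c 0 = c₀ := by
  rw [wVector_apply, Finset.sum_eq_zero]
  · simp
  · intro i _
    rw [if_neg]
    intro h
    simpa using congrFun h i

theorem single_one_injective :
    Function.Injective fun i : Fin N => (Pi.single i 1 : Fin N → Fin 2) := by
  intro i j h
  by_contra hij
  simpa [Pi.single_apply, hij] using congrFun h i

theorem wVector_single (c₀ : ℂ) (c : Fin N → ℂ) (i : Fin N) :
    wVector c₀ c (Pi.single i 1) = c i := by
  rw [wVector_apply, if_neg, Finset.sum_eq_single i]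
  · simp
  · intro j _ hj
    rw [if_neg]
    exact fun h => hj (single_one_injective h).symm
  · simp
  · intro h
    simpa using congrFun h i

theorem wVector_eq_zero_of_ne (c₀ : ℂ) (c : Fin N → ℂ) (b : Fin N → Fin 2) {i j : Fin N}
    (hij : i ≠ j) (hi : b i = 1) (hj : b j = 1) : wVector c₀ c b = 0 := by
  rw [wVector_apply, if_neg, Finset.sum_eq_zero, add_zero]
  · intro l _
    rw [if_neg]
    rintro rfl
    have h1 : i = l := by by_contra h; simp [h] at hi
    have h2 : j = l := by by_contra h; simp [h] at hj
    exact hij (h1.trans h2.symm)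
  · rintro rfl
    simp at hi

theorem smul_wVector (a c₀ : ℂ) (c : Fin N → ℂ) :
    a • wVector c₀ c = wVector (a * c₀) fun i => a * c i := by
  simp [wVector, smul_add, Finset.smul_sum, smul_smul]

/-- The vectors `wVector c₀ c` are stable under upper triangular local operators. -/
theorem applyAt_wVector (k : Fin N) (a b d : ℂ) (c₀ : ℂ) (c : Fin N → ℂ) :
    applyAt k !![a, b; 0, d] (wVector c₀ c) =
      wVector (a * c₀ + b * c k) fun i => (if i = k then d else a) * c i := by
  ext e
  rw [applyAt_apply, Fin.sum_univ_two]
  have he : Function.update e k (e k) = e := Function.update_eq_self k e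
  by_cases h1 : ∃ i, i ≠ k ∧ e i = 1
  · obtain ⟨i, hik, hi⟩ := h1
    have e1 : wVector c₀ c (Function.update e k 1) = 0 :=
      wVector_eq_zero_of_ne _ _ _ hik (by simp [hik, hi]) (by simp)
    rw [e1]
    by_cases hk : e k = 0
    · rw [hk, show Function.update e k 0 = e by rw [← hk, he]]
      by_cases h2 : ∃ j, j ≠ i ∧ e j = 1
      · obtain ⟨j, hji, hj⟩ := h2
        rw [wVector_eq_zero_of_ne _ _ e hji hj hi, wVector_eq_zero_of_ne _ _ e hji hj hi]
        simp
      · push Not at h2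
        have : e = Pi.single i 1 := by
          ext j
          by_cases hj : j = i
          · subst hj; simp [hi]
          · have := h2 j hj
            have h0 : e j = 0 := by omega
            simp [hj, h0]
        rw [this, wVector_single, wVector_single]
        simp [hik]
    · have hk1 : e k = 1 := by omega
      rw [wVector_eq_zero_of_ne _ _ e hik hi hk1, hk1]
      simp
  · push Not at h1
    have h0 : ∀ i, i ≠ k → e i = 0 := fun i hi => by have := h1 i hi; omega
    have u0 : Function.update e k 0 = 0 := by
      ext i
      by_cases hi : i = k
      · subst hi; simp
      · simp [hi, h0 i hi]
    have u1 : Function.update e k 1 = Pi.single k 1 := by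
      ext i
      by_cases hi : i = k
      · subst hi; simp
      · simp [hi, h0 i hi]
    rw [u0, u1, wVector_zero, wVector_single]
    by_cases hk : e k = 0
    · have : e = 0 := by rw [← u0, ← hk, he]
      rw [hk, this, wVector_zero]
      simp
    · have hk1 : e k = 1 := by omega
      have : e = Pi.single k 1 := by rw [← u1, ← hk1, he]
      rw [hk1, this, wVector_single]
      simp

end QubitSpace

open QubitSpace

/-! ### Elementary properties of the success probability -/

namespace LOCCProtocol

variable {N : ℕ}

theorem successProb_nonneg (Φ : QubitSpace N) (P : LOCCProtocol N) (ψ : QubitSpace N) :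
    0 ≤ P.successProb Φ ψ := by
  induction P generalizing ψ with
  | halt => rw [successProb]; split_ifs <;> positivity
  | measure k m M hM next ih => exact Finset.sum_nonneg fun j _ => ih j _

theorem successProb_le_norm_sq (Φ : QubitSpace N) (P : LOCCProtocol N) (ψ : QubitSpace N) :
    P.successProb Φ ψ ≤ ‖ψ‖ ^ 2 := by
  induction P generalizing ψ with
  | halt => rw [successProb]; split_ifs <;> first | exact le_rfl | positivity
  | measure k m M hM next ih =>
    rw [← sum_norm_sq_applyAt k M hM]
    exact Finset.sum_le_sum fun j _ => ih j _

theorem successProb_smul (Φ : QubitSpace N) (P : LOCCProtocol N) (ψ : QubitSpace N) {a : ℂ}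
    (ha : a ≠ 0) : P.successProb Φ (a • ψ) = ‖a‖ ^ 2 * P.successProb Φ ψ := by
  induction P generalizing ψ with
  | halt =>
    have h : (∃ c : ℂ, a • ψ = c • Φ) ↔ ∃ c : ℂ, ψ = c • Φ := by
      constructor
      · rintro ⟨c, hc⟩
        exact ⟨a⁻¹ * c, by rw [mul_smul, ← hc, inv_smul_smul₀ ha]⟩
      · rintro ⟨c, rfl⟩
        exact ⟨a * c, by rw [mul_smul]⟩
    rw [successProb, successProb]
    by_cases hψ : ∃ c : ℂ, ψ = c • Φ
    · rw [if_pos (h.2 hψ), if_pos hψ, norm_smul, mul_pow]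
    · rw [if_neg (mt h.1 hψ), if_neg hψ, mul_zero]
  | measure k m M hM next ih =>
    simp only [successProb, Finset.mul_sum, applyAt_smul, ih]

end LOCCProtocol

/-! ### Construction of protocols -/

/-- Some LOCC protocol converts `ψ` into `Φ` with probability at least `p`. -/
def Achieves {N : ℕ} (Φ : QubitSpace N) (p : ℝ) (ψ : QubitSpace N) : Prop :=
  ∃ P : LOCCProtocol N, p ≤ P.successProb Φ ψ

namespace Achieves

variable {N : ℕ} {Φ : QubitSpace N}

theorem zero (ψ : QubitSpace N) : Achieves Φ 0 ψ :=
  ⟨.halt, LOCCProtocol.successProb_nonneg _ _ _⟩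

theorem smul_self (hΦ : ‖Φ‖ = 1) (a : ℂ) : Achieves Φ (‖a‖ ^ 2) (a • Φ) := by
  refine ⟨.halt, ?_⟩
  rw [LOCCProtocol.successProb, if_pos ⟨a, rfl⟩, norm_smul, hΦ, mul_one]

theorem smul {p : ℝ} {ψ : QubitSpace N} (h : Achieves Φ p ψ) {a : ℂ} (ha : a ≠ 0) :
    Achieves Φ (‖a‖ ^ 2 * p) (a • ψ) := by
  obtain ⟨P, hP⟩ := h
  refine ⟨P, ?_⟩
  rw [LOCCProtocol.successProb_smul _ _ _ ha]
  gcongr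

theorem measure (k : Fin N) {m : ℕ} (M : Fin m → QubitOp) (hM : ∑ j, (M j)ᴴ * M j = 1)
    {ψ : QubitSpace N} {p : Fin m → ℝ} (h : ∀ j, Achieves Φ (p j) (applyAt k (M j) ψ)) :
    Achieves Φ (∑ j, p j) ψ := by
  choose P hP using h
  exact ⟨.measure k m M hM P, Finset.sum_le_sum fun j _ => hP j⟩

theorem of_applyAt_unitary (k : Fin N) {U : QubitOp} (hU : U ∈ Matrix.unitaryGroup (Fin 2) ℂ)
    {ψ : QubitSpace N} {p : ℝ} (h : Achieves Φ p (applyAt k U ψ)) : Achieves Φ p ψ := by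
  have := measure (Φ := Φ) (ψ := ψ) k (m := 1) (fun _ => U)
    (by simpa [Matrix.star_eq_conjTranspose] using Matrix.mem_unitaryGroup_iff'.1 hU) (p := fun _ => p) fun _ => h
  simpa using this

theorem of_applyAll_unitary {U : Fin N → QubitOp}
    (hU : ∀ i, U i ∈ Matrix.unitaryGroup (Fin 2) ℂ)
    {ψ : QubitSpace N} {p : ℝ} (h : Achieves Φ p (applyAll U ψ)) : Achieves Φ p ψ := by
  -- The parties apply their unitaries one at a time; `s` is the set of those that have acted.
  suffices H : ∀ s : Finset (Fin N),
      Achieves Φ p (applyAll (fun i => if i ∈ s then U i else 1) ψ) → Achieves Φ p ψ by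
    exact H Finset.univ (by simpa using h)
  intro s
  induction s using Finset.induction_on with
  | empty => simp [applyAll_one]
  | insert k s hk ih =>
    intro h
    refine ih (of_applyAt_unitary k (hU k) ?_)
    rw [applyAt_applyAll]
    convert h using 2
    ext1 i
    by_cases hi : i = k
    · subst hi; simp [hk]
    · simp [hi]

end Achieves

namespace QubitSpace

variable {N : ℕ} {Φ : QubitSpace N} {p : ℝ}

/-- The unnormalized vector `√z₀ |00⋯0⟩ + ∑ᵢ √zᵢ |i⟩`. -/
def sqrtVector (z₀ : ℝ) (z : Fin N → ℝ) : QubitSpace N :=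
  wVector ((√z₀ : ℝ) : ℂ) fun i => ((√(z i) : ℝ) : ℂ)

theorem smul_sqrtVector {a z₀ : ℝ} {z : Fin N → ℝ} (ha : 0 ≤ a) :
    ((√a : ℝ) : ℂ) • sqrtVector z₀ z = sqrtVector (a * z₀) fun i => a * z i := by
  rw [sqrtVector, smul_wVector]
  simp [sqrtVector, Real.sqrt_mul ha]

/-- A common phase of the amplitudes of the `|i⟩` can be removed by local unitaries. -/
theorem achieves_wVector_of_phase {e : ℂ} (he : ‖e‖ = 1) {c₀ : ℂ} {c : Fin N → ℂ}
    (h : Achieves Φ p (wVector c₀ fun i => e * c i)) : Achieves Φ p (wVector c₀ c) := by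
  have hU : !![1, 0; 0, e] ∈ Matrix.unitaryGroup (Fin 2) ℂ := by
    rw [Matrix.mem_unitaryGroup_iff']
    ext i j
    fin_cases i <;> fin_cases j <;>
      simp [Matrix.mul_apply, Matrix.star_eq_conjTranspose, Complex.conj_mul', he]
  suffices H : ∀ s : Finset (Fin N),
      Achieves Φ p (wVector c₀ fun i => (if i ∈ s then e else 1) * c i) →
        Achieves Φ p (wVector c₀ c) by
    exact H Finset.univ (by simpa using h)
  intro s
  induction s using Finset.induction_on with
  | empty => simp
  | insert k s hk ih =>
    intro h
    refine ih (.of_applyAt_unitary k hU ?_)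
    rw [applyAt_wVector]
    convert h using 2
    · simp
    · ext i
      by_cases hi : i = k
      · subst hi; simp [hk]
      · simp [hi]

/-- Party `k` filters with `diag(√s, √t)`; the complementary outcome counts as a failure. -/
theorem achieves_sqrtVector_of_filter (k : Fin N) {s t : ℝ} (hs : s ∈ Set.Icc (0 : ℝ) 1)
    (ht : t ∈ Set.Icc (0 : ℝ) 1) {z₀ : ℝ} {z : Fin N → ℝ}
    (h : Achieves Φ p (sqrtVector (s * z₀) fun i => (if i = k then t else s) * z i)) :
    Achieves Φ p (sqrtVector z₀ z) := by
  have hs' : 0 ≤ 1 - s := by linarith [hs.2]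
  have ht' : 0 ≤ 1 - t := by linarith [ht.2]
  have hM : ∑ j, (![!![((√s : ℝ) : ℂ), 0; 0, ((√t : ℝ) : ℂ)],
      !![((√(1 - s) : ℝ) : ℂ), 0; 0, ((√(1 - t) : ℝ) : ℂ)]] j)ᴴ *
      (![!![((√s : ℝ) : ℂ), 0; 0, ((√t : ℝ) : ℂ)],
      !![((√(1 - s) : ℝ) : ℂ), 0; 0, ((√(1 - t) : ℝ) : ℂ)]] j) = 1 := by
    ext i j
    fin_cases i <;> fin_cases j <;>
      simp [Matrix.mul_apply, Fin.sum_univ_two, ← Complex.ofReal_mul, hs.1, ht.1, hs', ht']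
  have := Achieves.measure (Φ := Φ) (ψ := sqrtVector z₀ z) k _ hM (p := ![p, 0]) ?_
  · simpa using this
  · intro j
    fin_cases j
    · simp only [Fin.zero_eta, Matrix.cons_val_zero]
      rw [sqrtVector, applyAt_wVector]
      convert h using 1
      rw [sqrtVector]
      congr 1
      · simp [Real.sqrt_mul hs.1]
      · ext i
        split_ifs
        · simp [Real.sqrt_mul ht.1]
        · simp [Real.sqrt_mul hs.1]
    · exact .zero _

/-- Party `k` reduces its coefficient by the factor `t`, moving the difference to the coefficient
of `|00⋯0⟩`; this succeeds with certainty. -/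
theorem achieves_sqrtVector_of_transfer (k : Fin N) {t : ℝ} (ht : t ∈ Set.Icc (0 : ℝ) 1)
    {z₀ : ℝ} (hz₀ : 0 ≤ z₀) {z : Fin N → ℝ} (hz : ∀ i, 0 ≤ z i)
    (h : Achieves Φ p (sqrtVector (z₀ + (1 - t) * z k)
      fun i => (if i = k then t else 1) * z i)) :
    Achieves Φ p (sqrtVector z₀ z) := by
  have ht' : 0 ≤ 1 - t := by linarith [ht.2]
  let a : ℂ := ((√(1 / 2) : ℝ) : ℂ)
  have ha : a * a = 1 / 2 := by
    rw [← Complex.ofReal_mul, Real.mul_self_sqrt (by norm_num)]; norm_num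
  have ha0 : a ≠ 0 := by rintro h0; rw [h0] at ha; norm_num at ha
  have han : ‖a‖ ^ 2 = 1 / 2 := by
    rw [Complex.norm_real, Real.norm_eq_abs, sq_abs, Real.sq_sqrt (by norm_num)]
  -- The Kraus operators are `a` times the triangular matrices with rows `(1, ±b)` and `(0, d)`. The
  -- two signs cancel the off-diagonal Gram terms, and since `b` is imaginary, `√z₀ ± b √(z k)` has
  -- squared modulus `z₀ + (1 - t) * z k` without interference.
  let b : ℂ := Complex.I * ((√(1 - t) : ℝ) : ℂ)
  have hb : (starRingEnd ℂ) b = -b := by simp [b]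
  have hbb : b * b = -(1 - t) := by
    calc b * b = Complex.I * Complex.I * ((√(1 - t) * √(1 - t) : ℝ) : ℂ) := by
          simp only [b]; push_cast; ring
      _ = _ := by rw [Real.mul_self_sqrt ht']; simp
  let d : ℂ := ((√t : ℝ) : ℂ)
  have hd : d * d = t := by rw [← Complex.ofReal_mul, Real.mul_self_sqrt ht.1]
  have hca : (starRingEnd ℂ) a = a := Complex.conj_ofReal _
  have hcd : (starRingEnd ℂ) d = d := Complex.conj_ofReal _
  have hM : ∑ j, (![!![a, a * b; 0, a * d], !![a, a * -b; 0, a * d]] j)ᴴ *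
      (![!![a, a * b; 0, a * d], !![a, a * -b; 0, a * d]] j) = 1 := by
    ext i j
    fin_cases i <;> fin_cases j <;>
      simp [Matrix.mul_apply, Fin.sum_univ_two, hca, hcd, hb]
    · linear_combination 2 * ha
    · linear_combination (-2 * b * b + 2 * d * d) * ha - hbb + hd
  have hout : ∀ w : ℂ, w * (starRingEnd ℂ) w = (1 - t : ℝ) → (starRingEnd ℂ) w = -w →
      Achieves Φ (1 / 2 * p) (applyAt k !![a, a * w; 0, a * d] (sqrtVector z₀ z)) := by
    intro w hw hcw
    -- The new amplitude of `|00⋯0⟩` has the right modulus but a phase `e`. Local unitaries give the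
    -- `|i⟩` the same phase, which then becomes global.
    obtain ⟨e, he, hew⟩ : ∃ e : ℂ, ‖e‖ = 1 ∧
        ((√z₀ : ℝ) : ℂ) + w * ((√(z k) : ℝ) : ℂ) = e * ((√(z₀ + (1 - t) * z k) : ℝ) : ℂ) := by
      set q := ((√z₀ : ℝ) : ℂ) + w * ((√(z k) : ℝ) : ℂ) with hq
      have hnq : ‖q‖ = √(z₀ + (1 - t) * z k) := by
        rw [← Real.sqrt_sq (norm_nonneg q)]
        congr 1
        apply Complex.ofReal_injective
        push_cast
        rw [← Complex.mul_conj', hq]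
        simp only [map_add, map_mul, Complex.conj_ofReal, hcw]
        have h1 : ((√z₀ : ℝ) : ℂ) * ((√z₀ : ℝ) : ℂ) = z₀ := by
          rw [← Complex.ofReal_mul, Real.mul_self_sqrt hz₀]
        have h2 : ((√(z k) : ℝ) : ℂ) * ((√(z k) : ℝ) : ℂ) = z k := by
          rw [← Complex.ofReal_mul, Real.mul_self_sqrt (hz k)]
        rw [hcw] at hw
        push_cast at hw
        linear_combination h1 + (z k : ℂ) * hw - w * w * h2
      rw [← hnq]
      by_cases hq0 : q = 0
      · exact ⟨1, by simp, by simp [hq0]⟩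
      · have : (‖q‖ : ℂ) ≠ 0 := by simpa using hq0
        exact ⟨q / ‖q‖, by simp [hq0], by field_simp⟩
    have he0 : e ≠ 0 := by rintro rfl; simp at he
    have h1 : Achieves Φ p (wVector (((√z₀ : ℝ) : ℂ) + w * ((√(z k) : ℝ) : ℂ))
        fun i => ((√((if i = k then t else 1) * z i) : ℝ) : ℂ)) := by
      apply achieves_wVector_of_phase he
      have := h.smul he0
      rw [sqrtVector, smul_wVector, he] at this
      rw [hew]
      simpa using this
    have h2 := h1.smul ha0
    rw [han, smul_wVector] at h2
    rw [sqrtVector, applyAt_wVector]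
    convert h2 using 2
    · ring
    · ext i
      split_ifs
      · rw [Real.sqrt_mul ht.1]; push_cast; ring
      · simp
  have := Achieves.measure (Φ := Φ) (ψ := sqrtVector z₀ z) k _ hM (p := fun _ => 1 / 2 * p) ?_
  · rw [Fin.sum_univ_two] at this
    convert this using 1
    ring
  · intro j
    fin_cases j
    · exact hout b (by rw [hb, mul_neg, hbb]; push_cast; ring) hb
    · exact hout (-b) (by rw [map_neg, hb]; rw [neg_neg, neg_mul, hbb]; push_cast; ring)
        (by rw [map_neg, hb])

/-- The parties act in turn: each transfers the fraction `θ` of its excess to `|00⋯0⟩` and filters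
off the rest. -/
theorem achieves_sqrtVector_of_le {θ : ℝ} (hθ : θ ∈ Set.Icc (0 : ℝ) 1) {z₀ : ℝ} (hz₀ : 0 ≤ z₀)
    {z w : Fin N → ℝ} (hw : ∀ i, 0 ≤ w i) (hwz : ∀ i, w i ≤ z i)
    (h : Achieves Φ p (sqrtVector (z₀ + θ * ∑ i, (z i - w i)) w)) :
    Achieves Φ p (sqrtVector z₀ z) := by
  have hz : ∀ i, 0 ≤ z i := fun i => (hw i).trans (hwz i)
  suffices H : ∀ s : Finset (Fin N), Achieves Φ p (sqrtVector (z₀ + θ * ∑ i ∈ s, (z i - w i))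
      fun i => if i ∈ s then w i else z i) → Achieves Φ p (sqrtVector z₀ z) by
    exact H Finset.univ (by simpa using h)
  intro s
  induction s using Finset.induction_on with
  | empty => simp
  | insert k s hk ih =>
    intro h
    apply ih
    -- The coefficient of party `k` between its transfer (factor `u / z k`) and its filter (factor
    -- `w k / u`). A zero denominator is harmless, as the numerator then vanishes too.
    set u := z k - θ * (z k - w k) with hu
    have hzw : 0 ≤ z k - w k := sub_nonneg.2 (hwz k)
    have hwu : w k ≤ u := by nlinarith [hθ.2]
    have huz : u ≤ z k := by nlinarith [mul_nonneg hθ.1 hzw]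
    have hu0 : 0 ≤ u := (hw k).trans hwu
    have hsum : 0 ≤ ∑ i ∈ s, (z i - w i) := Finset.sum_nonneg fun i _ => sub_nonneg.2 (hwz i)
    have e1 : u / z k * z k = u := by
      by_cases h0 : z k = 0
      · rw [h0] at huz ⊢; simp; linarith
      · field_simp
    have e2 : w k / u * u = w k := by
      by_cases h0 : u = 0
      · rw [h0] at hwu ⊢; simp; linarith [hw k]
      · field_simp
    apply achieves_sqrtVector_of_transfer k (t := u / z k)
      ⟨div_nonneg hu0 (hz k), div_le_one_of_le₀ huz (hz k)⟩
      (add_nonneg hz₀ (mul_nonneg hθ.1 hsum))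
      (fun i => by split_ifs; exacts [hw i, hz i])
    apply achieves_sqrtVector_of_filter k (s := 1) (t := w k / u) (by simp)
      ⟨div_nonneg (hw k) hu0, div_le_one_of_le₀ hwu hu0⟩
    convert h using 2
    · rw [Finset.sum_insert hk, if_neg hk, sub_mul, e1]
      simp only [hu]
      ring
    · ext i
      by_cases hi : i = k
      · subst hi; simp [hk, e1, e2]
      · simp [hi]

/-- The source `x` can be brought to the scaled target `q y` lying below it if `x₀ ≤ q y₀`, or if
party `k` attains equality and `x₀ / y₀ ≤ xᵢ / yᵢ` for all other parties. -/
theorem achieves_sqrtVector_smul {x y : Fin N → ℝ} {x₀ y₀ q : ℝ} (k : Fin N)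
    (hx₀ : 0 ≤ x₀) (hy₀ : 0 ≤ y₀) (hy : ∀ i, 0 ≤ y i)
    (hxs : x₀ + ∑ i, x i = 1) (hys : y₀ + ∑ i, y i = 1) (hq0 : 0 ≤ q) (hq1 : q ≤ 1)
    (hle : ∀ i, q * y i ≤ x i)
    (hor : x₀ ≤ q * y₀ ∨ (q * y k = x k ∧ ∀ i ≠ k, x₀ * y i ≤ y₀ * x i))
    (h : Achieves Φ p (sqrtVector (q * y₀) fun i => q * y i)) :
    Achieves Φ p (sqrtVector x₀ x) := by
  have hqy : ∀ i, 0 ≤ q * y i := fun i => mul_nonneg hq0 (hy i)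
  by_cases hc : x₀ ≤ q * y₀
  · set D := q * y₀ - x₀ with hD
    set S := ∑ i, (x i - q * y i) with hS
    -- Normalization of source and target: the total excess `S` of the parties covers the deficit
    -- `D` at `|00⋯0⟩`, so the fraction `D / S` is admissible.
    have hSD : S - D = 1 - q := by
      rw [hS, Finset.sum_sub_distrib, ← Finset.mul_sum]
      linear_combination hxs - q * hys
    have hD0 : 0 ≤ D := by linarith
    have hDS : D ≤ S := by linarith
    apply achieves_sqrtVector_of_le (θ := D / S)
      ⟨div_nonneg hD0 (hD0.trans hDS), div_le_one_of_le₀ hDS (hD0.trans hDS)⟩ hx₀ hqy hle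
    convert h using 2
    have : D / S * S = D := by
      by_cases h0 : S = 0
      · rw [h0] at hDS ⊢; simp; linarith
      · field_simp
    rw [← hS, this]
    ring
  · push Not at hc
    obtain ⟨hk, hi⟩ := hor.resolve_left hc.not_ge
    have hx₀' : 0 < x₀ := lt_of_le_of_lt (mul_nonneg hq0 hy₀) hc
    -- This `s` brings `x₀` exactly to `q * y₀`, while `t = 1` spares party `k`, which has nothing
    -- to lose. The remaining excesses are simply filtered off, hence `θ = 0` below.
    apply achieves_sqrtVector_of_filter k (s := q * y₀ / x₀) (t := 1)
      ⟨by positivity, div_le_one_of_le₀ hc.le hx₀⟩ (by simp)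
    apply achieves_sqrtVector_of_le (θ := 0) (by simp) (by positivity) hqy
    · intro i
      split_ifs with hik
      · subst hik; linarith
      · rw [div_mul_eq_mul_div, le_div_iff₀ hx₀']
        nlinarith [hi i hik]
    · convert h using 2
      field_simp
      ring

end QubitSpace

/-! ### Gram data of one-qubit operators -/

namespace QubitOp

/-- The squared norm of the first column. -/
def colNormSq (B : QubitOp) : ℝ := ((Bᴴ * B) 0 0).re

/-- The inner product of the two columns. -/
def colInner (B : QubitOp) : ℂ := (Bᴴ * B) 0 1

/-- The squared distance of the second column from the span of the first one (`0` if the first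
column vanishes). -/
def colDistSq (B : QubitOp) : ℝ := ‖B.det‖ ^ 2 / colNormSq B

theorem colNormSq_eq (B : QubitOp) : colNormSq B = ‖B 0 0‖ ^ 2 + ‖B 1 0‖ ^ 2 := by
  simp [colNormSq, Matrix.mul_apply, Fin.sum_univ_two, ← Complex.normSq_eq_norm_sq,
    Complex.normSq_apply]

theorem colNormSq_nonneg (B : QubitOp) : 0 ≤ colNormSq B := by
  rw [colNormSq_eq]; positivity

theorem colDistSq_nonneg (B : QubitOp) : 0 ≤ colDistSq B :=
  div_nonneg (by positivity) (colNormSq_nonneg B)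

theorem entries_eq_zero_of_colNormSq_eq_zero {B : QubitOp} (h : colNormSq B = 0) :
    B 0 0 = 0 ∧ B 1 0 = 0 := by
  rw [colNormSq_eq] at h
  constructor
  · have : ‖B 0 0‖ ^ 2 = 0 := le_antisymm (by nlinarith [sq_nonneg ‖B 1 0‖]) (by positivity)
    simpa using this
  · have : ‖B 1 0‖ ^ 2 = 0 := le_antisymm (by nlinarith [sq_nonneg ‖B 0 0‖]) (by positivity)
    simpa using this

theorem colInner_eq_zero_of_colNormSq_eq_zero {B : QubitOp} (h : colNormSq B = 0) :
    colInner B = 0 := by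
  obtain ⟨h0, h1⟩ := entries_eq_zero_of_colNormSq_eq_zero h
  simp [colInner, Matrix.mul_apply, Fin.sum_univ_two, h0, h1]

theorem colNormSq_pos {B : QubitOp} (h : B.det ≠ 0) : 0 < colNormSq B := by
  refine lt_of_le_of_ne (colNormSq_nonneg B) fun h0 => h ?_
  obtain ⟨h0, h1⟩ := entries_eq_zero_of_colNormSq_eq_zero h0.symm
  simp [Matrix.det_fin_two, h0, h1]

theorem colDistSq_pos {B : QubitOp} (h : B.det ≠ 0) : 0 < colDistSq B :=
  div_pos (by positivity) (colNormSq_pos h)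

theorem colDistSq_eq_zero {B : QubitOp} (h : B.det = 0) : colDistSq B = 0 := by
  simp [colDistSq, h]

/-- The determinant of the Gram matrix `Bᴴ * B`. -/
theorem norm_det_sq (B : QubitOp) :
    ‖B.det‖ ^ 2 = colNormSq B * ((Bᴴ * B) 1 1).re - ‖colInner B‖ ^ 2 := by
  simp only [colNormSq, colInner, Matrix.det_fin_two, Matrix.mul_apply, Fin.sum_univ_two,
    ← Complex.normSq_eq_norm_sq, Complex.normSq_apply, Matrix.conjTranspose_apply,
    RCLike.star_def, Complex.add_re, Complex.add_im, Complex.sub_re, Complex.sub_im,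
    Complex.mul_re, Complex.mul_im, Complex.conj_re, Complex.conj_im]
  ring

theorem colDistSq_eq {B : QubitOp} (h : colNormSq B ≠ 0) :
    colDistSq B = ((Bᴴ * B) 1 1).re - ‖colInner B‖ ^ 2 / colNormSq B := by
  rw [colDistSq, norm_det_sq]
  field_simp

/-- Only an inequality, because `colDistSq` is `0` by convention when the first column vanishes,
whatever the second column is. -/
theorem colDistSq_le (B : QubitOp) :
    colDistSq B ≤ ((Bᴴ * B) 1 1).re - ‖colInner B‖ ^ 2 / colNormSq B := by
  by_cases h : colNormSq B = 0
  · simp only [colDistSq, h, div_zero, sub_zero]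
    simp [Matrix.mul_apply, Fin.sum_univ_two]
    nlinarith [mul_self_nonneg (B 0 1).re, mul_self_nonneg (B 0 1).im,
      mul_self_nonneg (B 1 1).re, mul_self_nonneg (B 1 1).im]
  · exact (colDistSq_eq h).le

theorem gram_unitary_mul {U : QubitOp} (hU : U ∈ Matrix.unitaryGroup (Fin 2) ℂ) (B : QubitOp) :
    (U * B)ᴴ * (U * B) = Bᴴ * B := by
  have := Matrix.mem_unitaryGroup_iff'.1 hU
  rw [Matrix.star_eq_conjTranspose] at this
  rw [Matrix.conjTranspose_mul, Matrix.mul_assoc, ← Matrix.mul_assoc Uᴴ, this, Matrix.one_mul]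

theorem colNormSq_unitary_mul {U : QubitOp} (hU : U ∈ Matrix.unitaryGroup (Fin 2) ℂ)
    (B : QubitOp) : colNormSq (U * B) = colNormSq B := by
  rw [colNormSq, gram_unitary_mul hU, colNormSq]

theorem colInner_unitary_mul {U : QubitOp} (hU : U ∈ Matrix.unitaryGroup (Fin 2) ℂ)
    (B : QubitOp) : colInner (U * B) = colInner B := by
  rw [colInner, gram_unitary_mul hU, colInner]

theorem colDistSq_unitary_mul {U : QubitOp} (hU : U ∈ Matrix.unitaryGroup (Fin 2) ℂ)
    (B : QubitOp) : colDistSq (U * B) = colDistSq B := by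
  rw [colDistSq, colDistSq, norm_det_sq, norm_det_sq, colNormSq_unitary_mul hU,
    colInner_unitary_mul hU, gram_unitary_mul hU]

section Measurement

variable {m : ℕ} {M : Fin m → QubitOp}

theorem sum_gram (hM : ∑ j, (M j)ᴴ * M j = 1) (B : QubitOp) :
    ∑ j, (M j * B)ᴴ * (M j * B) = Bᴴ * B := by
  calc ∑ j, (M j * B)ᴴ * (M j * B) = Bᴴ * (∑ j, (M j)ᴴ * M j) * B := by
        simp only [Matrix.conjTranspose_mul, Matrix.mul_sum, Matrix.sum_mul, Matrix.mul_assoc]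
    _ = _ := by rw [hM, Matrix.mul_one]

theorem sum_colNormSq (hM : ∑ j, (M j)ᴴ * M j = 1) (B : QubitOp) :
    ∑ j, colNormSq (M j * B) = colNormSq B := by
  simp only [colNormSq]
  rw [← Complex.re_sum, ← Matrix.sum_apply, sum_gram hM]

theorem sum_colInner (hM : ∑ j, (M j)ᴴ * M j = 1) (B : QubitOp) :
    ∑ j, colInner (M j * B) = colInner B := by
  simp only [colInner]
  rw [← Matrix.sum_apply, sum_gram hM]

theorem sum_gram_one_one (hM : ∑ j, (M j)ᴴ * M j = 1) (B : QubitOp) :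
    ∑ j, (((M j * B)ᴴ * (M j * B)) 1 1).re = ((Bᴴ * B) 1 1).re := by
  rw [← Complex.re_sum, ← Matrix.sum_apply, sum_gram hM]

/-- The squared norm of the second column is conserved on average; it splits into the distance from
the first column and the projection onto it. -/
theorem sum_colDistSq_add_le (hM : ∑ j, (M j)ᴴ * M j = 1) (B : QubitOp)
    (h : colNormSq B ≠ 0) :
    ∑ j, colDistSq (M j * B) + ∑ j, ‖colInner (M j * B)‖ ^ 2 / colNormSq (M j * B) ≤
      colDistSq B + ‖colInner B‖ ^ 2 / colNormSq B := by
  rw [colDistSq_eq h, sub_add_cancel, ← sum_gram_one_one hM, ← Finset.sum_add_distrib]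
  exact Finset.sum_le_sum fun j _ => by linarith [colDistSq_le (M j * B)]

end Measurement

end QubitOp

/-! ### Cauchy–Schwarz, its equality case, and measurements on one qubit -/

/-- The Cauchy–Schwarz inequality in Engel form for complex numerators. -/
theorem norm_sum_sq_div_le {ι : Type*} (s : Finset ι) (z : ι → ℂ) (f : ι → ℝ)
    (hf : ∀ i ∈ s, 0 ≤ f i) (hz : ∀ i ∈ s, f i = 0 → z i = 0) :
    ‖∑ i ∈ s, z i‖ ^ 2 / ∑ i ∈ s, f i ≤ ∑ i ∈ s, ‖z i‖ ^ 2 / f i := by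
  have hg : ∀ i ∈ s, 0 ≤ ‖z i‖ ^ 2 / f i := fun i hi => div_nonneg (by positivity) (hf i hi)
  refine div_le_of_le_mul₀ (Finset.sum_nonneg hf) (Finset.sum_nonneg hg) ?_
  calc ‖∑ i ∈ s, z i‖ ^ 2 ≤ (∑ i ∈ s, ‖z i‖) ^ 2 := by gcongr; exact norm_sum_le _ _
    _ ≤ _ := by
      refine Finset.sum_sq_le_sum_mul_sum_of_sq_le_mul s hg hf fun i hi => le_of_eq ?_
      by_cases h : f i = 0
      · simp [h, hz i hi h]
      · field_simp

/-- The equality case of `norm_sum_sq_div_le`. -/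
theorem eq_mul_of_sum_norm_sq_div_le {ι : Type*} (s : Finset ι) (z : ι → ℂ) (f : ι → ℝ)
    (hf : ∀ i ∈ s, 0 ≤ f i) (hz : ∀ i ∈ s, f i = 0 → z i = 0) (hs : ∑ i ∈ s, f i ≠ 0)
    (h : ∑ i ∈ s, ‖z i‖ ^ 2 / f i ≤ ‖∑ i ∈ s, z i‖ ^ 2 / ∑ i ∈ s, f i) :
    ∀ i ∈ s, z i = (∑ i ∈ s, z i) / ((∑ i ∈ s, f i : ℝ) : ℂ) * f i := by
  set Z := ∑ i ∈ s, z i with hZ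
  set F := ∑ i ∈ s, f i with hF
  -- Summed over `i`, these weighted squared deviations from the common ratio `Z / F` give the
  -- defect of the inequality, so equality makes each one vanish.
  have hterm : ∀ i ∈ s, ‖z i - Z / F * f i‖ ^ 2 / f i =
      ‖z i‖ ^ 2 / f i - 2 * (((starRingEnd ℂ) (Z / F)) * z i).re + ‖Z / F‖ ^ 2 * f i := by
    intro i hi
    by_cases h0 : f i = 0
    · simp [h0, hz i hi h0]
    · generalize Z / (F : ℂ) = t
      field_simp
      simp only [← Complex.normSq_eq_norm_sq, Complex.normSq_apply, Complex.sub_re,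
        Complex.sub_im, Complex.mul_re, Complex.mul_im, Complex.conj_re, Complex.conj_im,
        Complex.ofReal_re, Complex.ofReal_im]
      ring
  have hsum : ∑ i ∈ s, ‖z i - Z / F * f i‖ ^ 2 / f i ≤ 0 := by
    rw [Finset.sum_congr rfl hterm, Finset.sum_add_distrib, Finset.sum_sub_distrib,
      ← Finset.mul_sum, ← Finset.mul_sum, ← Complex.re_sum, ← Finset.mul_sum, ← hZ, ← hF]
    have e1 : ((starRingEnd ℂ) (Z / F) * Z).re = ‖Z‖ ^ 2 / F := by
      rw [map_div₀, Complex.conj_ofReal, div_mul_eq_mul_div, Complex.conj_mul',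
        ← Complex.ofReal_pow, ← Complex.ofReal_div, Complex.ofReal_re]
    have e2 : ‖Z / F‖ ^ 2 * F = ‖Z‖ ^ 2 / F := by
      rw [norm_div, div_pow, Complex.norm_real, Real.norm_eq_abs, sq_abs]
      field_simp
    rw [e1, e2]
    linarith
  have hnn : ∀ i ∈ s, 0 ≤ ‖z i - Z / F * f i‖ ^ 2 / f i := fun i hi =>
    div_nonneg (by positivity) (hf i hi)
  intro i hi
  by_cases h0 : f i = 0
  · simp [h0, hz i hi h0]
  · have := (Finset.sum_eq_zero_iff_of_nonneg hnn).1
      (le_antisymm hsum (Finset.sum_nonneg hnn)) i hi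
    rw [div_eq_zero_iff, or_iff_left h0] at this
    exact sub_eq_zero.1 (by simpa using this)

namespace QubitOp

variable {m : ℕ} {M : Fin m → QubitOp}

theorem norm_colInner_sq_div_le (hM : ∑ j, (M j)ᴴ * M j = 1) (B : QubitOp) :
    ‖colInner B‖ ^ 2 / colNormSq B ≤
      ∑ j, ‖colInner (M j * B)‖ ^ 2 / colNormSq (M j * B) := by
  rw [← sum_colNormSq hM B, ← sum_colInner hM B]
  exact norm_sum_sq_div_le _ _ _ (fun _ _ => colNormSq_nonneg _)
    fun _ _ => colInner_eq_zero_of_colNormSq_eq_zero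

/-- By Cauchy–Schwarz the projection part of the second column can only grow on average, so the
distance part can only shrink. -/
theorem sum_colDistSq_le (hM : ∑ j, (M j)ᴴ * M j = 1) (B : QubitOp) :
    ∑ j, colDistSq (M j * B) ≤ colDistSq B := by
  by_cases h : colNormSq B = 0
  · rw [Finset.sum_eq_zero]
    · exact colDistSq_nonneg B
    · intro j _
      obtain ⟨h0, h1⟩ := entries_eq_zero_of_colNormSq_eq_zero h
      apply colDistSq_eq_zero
      rw [Matrix.det_mul, Matrix.det_fin_two B, h0, h1]
      simp
  · linarith [sum_colDistSq_add_le hM B h, norm_colInner_sq_div_le hM B]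

theorem colInner_eq_of_sum_colDistSq_eq (hM : ∑ j, (M j)ᴴ * M j = 1) (B : QubitOp)
    (h : colNormSq B ≠ 0)
    (heq : ∑ j, colDistSq (M j * B) = colDistSq B) (j : Fin m) :
    colInner (M j * B) = colInner B / (colNormSq B : ℂ) * (colNormSq (M j * B) : ℂ) := by
  have := eq_mul_of_sum_norm_sq_div_le Finset.univ (fun j => colInner (M j * B))
    (fun j => colNormSq (M j * B)) (fun _ _ => colNormSq_nonneg _)
    (fun _ _ => colInner_eq_zero_of_colNormSq_eq_zero) (by rwa [sum_colNormSq hM])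
    (by rw [sum_colNormSq hM, sum_colInner hM]; linarith [sum_colDistSq_add_le hM B h])
    j (Finset.mem_univ j)
  rwa [sum_colNormSq hM, sum_colInner hM] at this

end QubitOp

open QubitOp

namespace QubitSpace

variable {N : ℕ}

/-! ### States of the form `(A₁ ⊗ ⋯ ⊗ A_N) ∑ᵢ |i⟩` -/

/-- The unnormalized W state `∑ᵢ |i⟩`. -/
def wSum (N : ℕ) : QubitSpace N := wVector 0 fun _ => 1

theorem bits_cases (b : Fin N → Fin 2) :
    b = 0 ∨ (∃ i, b = Pi.single i 1) ∨ ∃ i j, i ≠ j ∧ b i = 1 ∧ b j = 1 := by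
  by_cases h0 : ∃ i, b i = 1
  · obtain ⟨i, hi⟩ := h0
    by_cases h1 : ∃ j, i ≠ j ∧ b j = 1
    · obtain ⟨j, hij, hj⟩ := h1
      exact .inr (.inr ⟨i, j, hij, hi, hj⟩)
    · push Not at h1
      refine .inr (.inl ⟨i, ?_⟩)
      ext j
      by_cases hj : j = i
      · subst hj; simp [hi]
      · have := h1 j (Ne.symm hj)
        have h0 : b j = 0 := by omega
        simp [hj, h0]
  · push Not at h0
    refine .inl ?_
    ext j
    have := h0 j
    have h0 : b j = 0 := by omega
    simp [h0]

theorem applyAll_wSum_apply (C : Fin N → QubitOp) (b : Fin N → Fin 2) :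
    applyAll C (wSum N) b =
      ∑ i, C i (b i) 1 * ∏ j ∈ Finset.univ.erase i, C j (b j) 0 := by
  simp only [applyAll_apply, wSum, wVector_apply, ite_self, zero_add, Finset.mul_sum]
  rw [Finset.sum_comm]
  refine Finset.sum_congr rfl fun i _ => ?_
  rw [Finset.sum_eq_single (Pi.single i 1)]
  · rw [if_pos rfl, mul_one, ← Finset.mul_prod_erase _ _ (Finset.mem_univ i), Pi.single_eq_same]
    congr 1
    refine Finset.prod_congr rfl fun j hj => ?_
    rw [Pi.single_eq_of_ne (Finset.ne_of_mem_erase hj)]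
  · intro c _ hc
    simp [hc]
  · simp

theorem applyAll_wSum_of_triangular (C : Fin N → QubitOp) (hC : ∀ k, C k 1 0 = 0) :
    applyAll C (wSum N) = wVector (∑ i, C i 0 1 * ∏ j ∈ Finset.univ.erase i, C j 0 0)
      fun i => C i 1 1 * ∏ j ∈ Finset.univ.erase i, C j 0 0 := by
  ext b
  rw [applyAll_wSum_apply]
  rcases bits_cases b with rfl | ⟨i, rfl⟩ | ⟨i, j, hij, hi, hj⟩
  · rw [wVector_zero]
    rfl
  · rw [wVector_single, Finset.sum_eq_single i, Pi.single_eq_same]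
    · congr 1
      refine Finset.prod_congr rfl fun j hj => ?_
      rw [Pi.single_eq_of_ne (Finset.ne_of_mem_erase hj)]
    · intro j _ hj
      rw [Finset.prod_eq_zero (Finset.mem_erase.2 ⟨hj.symm, Finset.mem_univ i⟩), mul_zero]
      rw [Pi.single_eq_same, hC]
    · simp
  · rw [wVector_eq_zero_of_ne _ _ _ hij hi hj]
    refine Finset.sum_eq_zero fun l _ => ?_
    by_cases hl : l = i
    · rw [Finset.prod_eq_zero (Finset.mem_erase.2 ⟨fun h => hij (hl ▸ h.symm), Finset.mem_univ j⟩),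
        mul_zero]
      rw [hj, hC]
    · rw [Finset.prod_eq_zero (Finset.mem_erase.2 ⟨fun h => hl h.symm, Finset.mem_univ i⟩),
        mul_zero]
      rw [hi, hC]

/-- For at least three parties, the local operators taking `∑ᵢ |i⟩` to a vector
`c₀ |00⋯0⟩ + ∑ᵢ cᵢ |i⟩` with all `cᵢ ≠ 0` preserve the line of `|0⟩`. -/
theorem triangular_of_applyAll_wSum_eq (hN : 3 ≤ N) (C : Fin N → QubitOp) {c₀ : ℂ}
    {c : Fin N → ℂ} (hc : ∀ i, c i ≠ 0) (h : applyAll C (wSum N) = wVector c₀ c) (k : Fin N) :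
    C k 1 0 = 0 := by
  obtain ⟨l, m, hlk, hmk, hlm⟩ : ∃ l m : Fin N, l ≠ k ∧ m ≠ k ∧ l ≠ m := by
    have h2 : 1 < (Finset.univ.erase k).card := by
      rw [Finset.card_erase_of_mem (Finset.mem_univ k), Finset.card_univ, Fintype.card_fin]
      omega
    obtain ⟨l, hl, m, hm, hlm⟩ := Finset.one_lt_card.1 h2
    exact ⟨l, m, Finset.ne_of_mem_erase hl, Finset.ne_of_mem_erase hm, hlm⟩
  by_contra hq
  set D := C k 0 0 * C k 1 1 - C k 1 0 * C k 0 1 with hD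
  -- Contracting qubit `k` with the functional that kills the first column of `C k` leaves only the
  -- term in which `k` carries the excitation, a product vector on the other qubits.
  have contract : ∀ b : Fin N → Fin 2,
      C k 0 0 * wVector c₀ c (Function.update b k 1) - C k 1 0 * wVector c₀ c (Function.update b k 0)
        = D * ∏ j ∈ Finset.univ.erase k, C j (b j) 0 := by
    intro b
    have expand : ∀ a : Fin 2, wVector c₀ c (Function.update b k a) =
        C k a 1 * ∏ j ∈ Finset.univ.erase k, C j (b j) 0 +
        C k a 0 * ∑ i ∈ Finset.univ.erase k, C i (b i) 1 *
          ∏ j ∈ (Finset.univ.erase i).erase k, C j (b j) 0 := by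
      intro a
      rw [← h, applyAll_wSum_apply, ← Finset.add_sum_erase _ _ (Finset.mem_univ k),
        Function.update_self, Finset.mul_sum]
      congr 1
      · congr 1
        refine Finset.prod_congr rfl fun j hj => ?_
        rw [Function.update_of_ne (Finset.ne_of_mem_erase hj)]
      · refine Finset.sum_congr rfl fun i hi => ?_
        have hik := Finset.ne_of_mem_erase hi
        rw [Function.update_of_ne hik, ← Finset.mul_prod_erase _ _
          (Finset.mem_erase.2 ⟨hik.symm, Finset.mem_univ k⟩), Function.update_self, mul_left_comm]
        congr 2
        refine Finset.prod_congr rfl fun j hj => ?_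
        rw [Function.update_of_ne (Finset.ne_of_mem_erase hj)]
    rw [expand, expand, hD]
    ring
  have split : ∀ f : Fin N → ℂ, ∏ j ∈ Finset.univ.erase k, f j =
      f l * (f m * ∏ j ∈ ((Finset.univ.erase k).erase l).erase m, f j) := by
    intro f
    rw [← Finset.mul_prod_erase (Finset.univ.erase k) f (a := l) (by simp [hlk]),
      ← Finset.mul_prod_erase ((Finset.univ.erase k).erase l) f (a := m)
        (by simp [hmk, hlm.symm])]
  set R := ∏ j ∈ ((Finset.univ.erase k).erase l).erase m, C j 0 0 with hR
  have rest : ∀ b : Fin N → Fin 2, (∀ j, j ≠ l → j ≠ m → b j = 0) →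
      ∏ j ∈ ((Finset.univ.erase k).erase l).erase m, C j (b j) 0 = R := by
    intro b hb
    refine Finset.prod_congr rfl fun j hj => ?_
    simp only [Finset.mem_erase] at hj
    rw [hb j hj.2.1 hj.1]
  have upd0 : ∀ j, j ≠ k → Function.update (Pi.single j 1 : Fin N → Fin 2) k 0 = Pi.single j 1 :=
    fun j hj => by
      rw [Function.update_eq_self_iff, Pi.single_eq_of_ne hj.symm]
  have e1 := contract (Pi.single l 1)
  have e2 := contract (Pi.single m 1)
  have e3 := contract (Function.update (Pi.single l 1) m 1)
  rw [split, rest _ (fun j hjl _ => Pi.single_eq_of_ne hjl _), upd0 l hlk, wVector_single,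
    wVector_eq_zero_of_ne _ _ _ hlk (by simp [hlk]) (by simp), Pi.single_eq_same,
    Pi.single_eq_of_ne hlm.symm] at e1
  rw [split, rest _ (fun j _ hjm => Pi.single_eq_of_ne hjm _), upd0 m hmk, wVector_single,
    wVector_eq_zero_of_ne _ _ _ hmk (by simp [hmk]) (by simp), Pi.single_eq_same,
    Pi.single_eq_of_ne hlm] at e2
  rw [split, rest _ (fun j hjl hjm => by simp [hjm, hjl]),
    wVector_eq_zero_of_ne _ _ _ hlk (by simp [hlk, hlm]) (by simp),
    wVector_eq_zero_of_ne _ _ _ hlm (by simp [hlk, hlm]) (by simp [hmk]),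
    Function.update_self, Function.update_of_ne hlm, Pi.single_eq_same] at e3
  -- For a product vector, the values at the excitations `l` and `m` multiply to the value at the
  -- double excitation times that at zero. The double one vanishes in a `wVector`; this uses two
  -- parties besides `k`.
  have : C k 1 0 * C k 1 0 * c l * c m = 0 := by
    linear_combination (-C k 1 0 * c m) * e1 + (D * C l 1 0 * C m 0 0 * R) * e2 -
      (D * C l 0 0 * C m 0 0 * R) * e3
  simp [hq, hc] at this

/-! ### The unnormalized coefficients of such states -/

/-- The unnormalized coefficient of party `i`. -/
def wCoeff (A : Fin N → QubitOp) (i : Fin N) : ℝ :=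
  (∏ j ∈ Finset.univ.erase i, colNormSq (A j)) * colDistSq (A i)

/-- The overlap with the product of the first columns. -/
def wOverlap (A : Fin N → QubitOp) : ℂ :=
  ∑ i, (∏ j ∈ Finset.univ.erase i, (colNormSq (A j) : ℂ)) * colInner (A i)

/-- The unnormalized coefficient of `|00⋯0⟩`. -/
def wCoeffZero (A : Fin N → QubitOp) : ℝ := ‖wOverlap A‖ ^ 2 / ∏ j, colNormSq (A j)

theorem wCoeff_nonneg (A : Fin N → QubitOp) (i : Fin N) : 0 ≤ wCoeff A i :=
  mul_nonneg (Finset.prod_nonneg fun _ _ => colNormSq_nonneg _) (colDistSq_nonneg _)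

theorem wCoeff_pos {A : Fin N → QubitOp} (hA : ∀ k, (A k).det ≠ 0) (i : Fin N) :
    0 < wCoeff A i :=
  mul_pos (Finset.prod_pos fun _ _ => colNormSq_pos (hA _)) (colDistSq_pos (hA _))

theorem wCoeff_eq_zero {A : Fin N → QubitOp} {i : Fin N} (h : (A i).det = 0) :
    wCoeff A i = 0 := by
  rw [wCoeff, colDistSq_eq_zero h, mul_zero]

theorem wCoeff_unitary_mul {U : Fin N → QubitOp}
    (hU : ∀ i, U i ∈ Matrix.unitaryGroup (Fin 2) ℂ) (A : Fin N → QubitOp) :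
    wCoeff (fun i => U i * A i) = wCoeff A := by
  ext i
  simp only [wCoeff, colNormSq_unitary_mul (hU _), colDistSq_unitary_mul (hU _)]

theorem wCoeffZero_unitary_mul {U : Fin N → QubitOp}
    (hU : ∀ i, U i ∈ Matrix.unitaryGroup (Fin 2) ℂ) (A : Fin N → QubitOp) :
    wCoeffZero (fun i => U i * A i) = wCoeffZero A := by
  simp only [wCoeffZero, wOverlap, colNormSq_unitary_mul (hU _), colInner_unitary_mul (hU _)]

theorem colNormSq_of_triangular {B : QubitOp} (h : B 1 0 = 0) : colNormSq B = ‖B 0 0‖ ^ 2 := by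
  simp [colNormSq_eq, h]

theorem wCoeff_of_triangular {C : Fin N → QubitOp} (hC : ∀ k, C k 1 0 = 0)
    (h0 : ∀ k, C k 0 0 ≠ 0) (i : Fin N) :
    wCoeff C i = ‖C i 1 1 * ∏ j ∈ Finset.univ.erase i, C j 0 0‖ ^ 2 := by
  have : colDistSq (C i) = ‖C i 1 1‖ ^ 2 := by
    have := h0 i
    rw [colDistSq, colNormSq_of_triangular (hC i), Matrix.det_fin_two, hC i, mul_zero, sub_zero,
      norm_mul]
    field_simp
  simp only [wCoeff, this, colNormSq_of_triangular (hC _)]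
  rw [norm_mul, mul_pow, norm_prod, Finset.prod_pow, mul_comm]

theorem wCoeffZero_of_triangular {C : Fin N → QubitOp} (hC : ∀ k, C k 1 0 = 0)
    (h0 : ∀ k, C k 0 0 ≠ 0) :
    wCoeffZero C = ‖∑ i, C i 0 1 * ∏ j ∈ Finset.univ.erase i, C j 0 0‖ ^ 2 := by
  have hov : wOverlap C = (∏ j, (starRingEnd ℂ) (C j 0 0)) *
      ∑ i, C i 0 1 * ∏ j ∈ Finset.univ.erase i, C j 0 0 := by
    rw [wOverlap, Finset.mul_sum]
    refine Finset.sum_congr rfl fun i _ => ?_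
    rw [← Finset.mul_prod_erase _ (fun j => (starRingEnd ℂ) (C j 0 0)) (Finset.mem_univ i)]
    have h1 : colInner (C i) = (starRingEnd ℂ) (C i 0 0) * C i 0 1 := by
      simp [colInner, Matrix.mul_apply, Fin.sum_univ_two, hC i]
    have h2 : ∏ j ∈ Finset.univ.erase i, (colNormSq (C j) : ℂ) =
        (∏ j ∈ Finset.univ.erase i, (starRingEnd ℂ) (C j 0 0)) *
          ∏ j ∈ Finset.univ.erase i, C j 0 0 := by
      rw [← Finset.prod_mul_distrib]
      refine Finset.prod_congr rfl fun j _ => ?_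
      rw [colNormSq_of_triangular (hC j), Complex.conj_mul']
      push_cast
      rfl
    rw [h1, h2]
    ring
  have hp : ∏ j, ‖C j 0 0‖ ≠ 0 := Finset.prod_ne_zero_iff.2 fun j _ => by simpa using h0 j
  rw [wCoeffZero, hov, norm_mul, mul_pow, norm_prod]
  simp only [RCLike.norm_conj, colNormSq_of_triangular (hC _), Finset.prod_pow]
  field_simp

/-- `wCoeff` and `wCoeffZero` are determined by the state. -/
theorem wCoeff_of_applyAll_wSum_eq (hN : 3 ≤ N) (C : Fin N → QubitOp) {c₀ : ℂ}
    {c : Fin N → ℂ} (hc : ∀ i, c i ≠ 0) (h : applyAll C (wSum N) = wVector c₀ c) :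
    (∀ i, wCoeff C i = ‖c i‖ ^ 2) ∧ wCoeffZero C = ‖c₀‖ ^ 2 := by
  have hC := triangular_of_applyAll_wSum_eq hN C hc h
  rw [applyAll_wSum_of_triangular C hC] at h
  have hi : ∀ i, C i 1 1 * ∏ j ∈ Finset.univ.erase i, C j 0 0 = c i := fun i => by
    rw [← wVector_single c₀ c i, ← h, wVector_single]
  have hz : ∑ i, C i 0 1 * ∏ j ∈ Finset.univ.erase i, C j 0 0 = c₀ := by
    rw [← wVector_zero c₀ c, ← h, wVector_zero]
  -- The entry `C k 0 0` is a factor of the nonzero amplitude `c i` of any other party `i`.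
  have h0 : ∀ k, C k 0 0 ≠ 0 := by
    intro k h0
    have : Nontrivial (Fin N) := Fin.nontrivial_iff_two_le.2 (by omega)
    obtain ⟨i, hik⟩ := exists_ne k
    refine hc i ?_
    rw [← hi, Finset.prod_eq_zero (Finset.mem_erase.2 ⟨hik.symm, Finset.mem_univ k⟩) h0, mul_zero]
  exact ⟨fun i => by rw [wCoeff_of_triangular hC h0, hi],
    by rw [wCoeffZero_of_triangular hC h0, hz]⟩

/-- The vectors `√x₀ |00⋯0⟩ + ∑ᵢ √xᵢ |i⟩` are images of `∑ᵢ |i⟩` under local operators. -/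
theorem exists_applyAll_wSum_eq_canonicalState (k : Fin N) {x : Fin N → ℝ} (hx : ∀ i, 0 ≤ x i)
    (hx₀ : 0 ≤ coeffZero x) :
    ∃ B : Fin N → QubitOp, canonicalState x = applyAll B (wSum N) ∧
      (∀ i, wCoeff B i = x i) ∧ wCoeffZero B = coeffZero x ∧
      ∀ i, (B i).det = ((√(x i) : ℝ) : ℂ) := by
  -- Party `k` alone produces the amplitude of `|00⋯0⟩`; the choice of `k` is immaterial.
  let B : Fin N → QubitOp := fun i =>
    !![1, if i = k then ((√(coeffZero x) : ℝ) : ℂ) else 0; 0, ((√(x i) : ℝ) : ℂ)]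
  have hB : ∀ i, B i 1 0 = 0 := fun i => rfl
  have hB0 : ∀ i, B i 0 0 = 1 := fun i => rfl
  have hB1 : ∀ i, B i 1 1 = ((√(x i) : ℝ) : ℂ) := fun i => rfl
  have hB01 : ∀ i, B i 0 1 = if i = k then ((√(coeffZero x) : ℝ) : ℂ) else 0 := fun i => rfl
  refine ⟨B, ?_, fun i => ?_, ?_, fun i => ?_⟩
  · rw [applyAll_wSum_of_triangular B hB, canonicalState_eq_wVector]
    simp [hB0, hB1, hB01]
  · rw [wCoeff_of_triangular hB (by simp [hB0])]
    simp [hB0, hB1, hx i]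
  · rw [wCoeffZero_of_triangular hB (by simp [hB0])]
    simp [hB0, hB01, hx₀]
  · simp [Matrix.det_fin_two, hB, hB0, hB1]

/-! ### Behaviour under a local measurement -/

theorem wCoeff_update_self (A : Fin N → QubitOp) (k : Fin N) (B : QubitOp) :
    wCoeff (Function.update A k B) k =
      (∏ j ∈ Finset.univ.erase k, colNormSq (A j)) * colDistSq B := by
  rw [wCoeff, Function.update_self]
  congr 1
  refine Finset.prod_congr rfl fun j hj => ?_
  rw [Function.update_of_ne (Finset.ne_of_mem_erase hj)]

theorem wCoeff_update_of_ne (A : Fin N → QubitOp) {i k : Fin N} (hik : i ≠ k) (B : QubitOp) :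
    wCoeff (Function.update A k B) i = colNormSq B *
      ((∏ j ∈ (Finset.univ.erase i).erase k, colNormSq (A j)) * colDistSq (A i)) := by
  rw [wCoeff, Function.update_of_ne hik, ← mul_assoc, ← Finset.mul_prod_erase _ _
    (Finset.mem_erase.2 ⟨hik.symm, Finset.mem_univ k⟩), Function.update_self]
  congr 2
  refine Finset.prod_congr rfl fun j hj => ?_
  rw [Function.update_of_ne (Finset.ne_of_mem_erase hj)]

theorem prod_colNormSq_update (A : Fin N → QubitOp) (k : Fin N) (B : QubitOp) :
    ∏ j, colNormSq (Function.update A k B j) =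
      colNormSq B * ∏ j ∈ Finset.univ.erase k, colNormSq (A j) := by
  rw [← Finset.mul_prod_erase _ _ (Finset.mem_univ k), Function.update_self]
  congr 1
  refine Finset.prod_congr rfl fun j hj => ?_
  rw [Function.update_of_ne (Finset.ne_of_mem_erase hj)]

/-- The overlap is linear in the Gram data `colNormSq B` and `colInner B` of one factor, hence
additive over measurement outcomes. -/
theorem wOverlap_update (A : Fin N → QubitOp) (k : Fin N) (B : QubitOp) :
    wOverlap (Function.update A k B) =
      (∏ j ∈ Finset.univ.erase k, (colNormSq (A j) : ℂ)) * colInner B +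
      (colNormSq B : ℂ) * ∑ i ∈ Finset.univ.erase k,
        (∏ j ∈ (Finset.univ.erase i).erase k, (colNormSq (A j) : ℂ)) * colInner (A i) := by
  rw [wOverlap, ← Finset.add_sum_erase _ _ (Finset.mem_univ k), Function.update_self,
    Finset.mul_sum]
  congr 1
  · congr 1
    refine Finset.prod_congr rfl fun j hj => ?_
    rw [Function.update_of_ne (Finset.ne_of_mem_erase hj)]
  · refine Finset.sum_congr rfl fun i hi => ?_
    have hik := Finset.ne_of_mem_erase hi
    rw [Function.update_of_ne hik, ← mul_assoc, ← Finset.mul_prod_erase _ _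
      (Finset.mem_erase.2 ⟨hik.symm, Finset.mem_univ k⟩), Function.update_self]
    congr 2
    refine Finset.prod_congr rfl fun j hj => ?_
    rw [Function.update_of_ne (Finset.ne_of_mem_erase hj)]

/-- The coefficients of the parties do not increase on average. -/
theorem sum_wCoeff_le (A : Fin N → QubitOp) (k : Fin N) {m : ℕ} {M : Fin m → QubitOp}
    (hM : ∑ j, (M j)ᴴ * M j = 1) (i : Fin N) :
    ∑ j, wCoeff (Function.update A k (M j * A k)) i ≤ wCoeff A i := by
  conv_rhs => rw [← Function.update_eq_self k A]
  by_cases hik : i = k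
  · subst hik
    simp only [wCoeff_update_self, ← Finset.mul_sum]
    exact mul_le_mul_of_nonneg_left (sum_colDistSq_le hM _)
      (Finset.prod_nonneg fun _ _ => colNormSq_nonneg _)
  · simp only [wCoeff_update_of_ne A hik, ← Finset.sum_mul]
    rw [sum_colNormSq hM]

/-- The coefficient of `|00⋯0⟩` does not decrease on average. -/
theorem wCoeffZero_le_sum (A : Fin N → QubitOp) (k : Fin N) {m : ℕ} {M : Fin m → QubitOp}
    (hM : ∑ j, (M j)ᴴ * M j = 1) :
    wCoeffZero A ≤ ∑ j, wCoeffZero (Function.update A k (M j * A k)) := by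
  have h1 : wOverlap A = ∑ j, wOverlap (Function.update A k (M j * A k)) := by
    conv_lhs => rw [← Function.update_eq_self k A]
    simp only [wOverlap_update]
    rw [Finset.sum_add_distrib, ← Finset.mul_sum, ← Finset.sum_mul, sum_colInner hM,
      ← Complex.ofReal_sum, sum_colNormSq hM]
  have h2 : ∏ l, colNormSq (A l) =
      ∑ j, ∏ l, colNormSq (Function.update A k (M j * A k) l) := by
    conv_lhs => rw [← Function.update_eq_self k A]
    simp only [prod_colNormSq_update, ← Finset.sum_mul]
    rw [sum_colNormSq hM]
  simp only [wCoeffZero]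
  rw [h1, h2]
  refine norm_sum_sq_div_le _ _ _
    (fun j _ => Finset.prod_nonneg fun _ _ => colNormSq_nonneg _) fun j _ h0 => ?_
  rw [Finset.prod_eq_zero_iff] at h0
  obtain ⟨l, -, hl⟩ := h0
  rw [wOverlap]
  refine Finset.sum_eq_zero fun i _ => ?_
  by_cases hil : l = i
  · subst hil
    rw [colInner_eq_zero_of_colNormSq_eq_zero hl, mul_zero]
  · rw [Finset.prod_eq_zero (Finset.mem_erase.2 ⟨hil, Finset.mem_univ l⟩) (by rw [hl]; simp),
      zero_mul]

/-- If a measurement of party `k` preserves its coefficient on average, then every outcome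
rescales the overlap. -/
theorem wCoeffZero_update_of_sum_colDistSq_eq (A : Fin N → QubitOp) (k : Fin N) {m : ℕ}
    {M : Fin m → QubitOp} (hM : ∑ j, (M j)ᴴ * M j = 1) (hA : 0 < colNormSq (A k))
    (heq : ∑ j, colDistSq (M j * A k) = colDistSq (A k)) (j : Fin m) :
    wCoeffZero (Function.update A k (M j * A k)) =
      colNormSq (M j * A k) / colNormSq (A k) * wCoeffZero A := by
  have hne : (colNormSq (A k) : ℂ) ≠ 0 := by exact_mod_cast hA.ne'
  have h1 : wOverlap (Function.update A k (M j * A k)) =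
      ((colNormSq (M j * A k) / colNormSq (A k) : ℝ) : ℂ) * wOverlap A := by
    conv_rhs => rw [← Function.update_eq_self k A]
    rw [wOverlap_update, wOverlap_update, colInner_eq_of_sum_colDistSq_eq hM _ hA.ne' heq j]
    push_cast
    simp only [Function.update_eq_self]
    field_simp
  have h2 : ∏ l, colNormSq (Function.update A k (M j * A k) l) =
      colNormSq (M j * A k) / colNormSq (A k) * ∏ l, colNormSq (A l) := by
    conv_rhs => rw [← Function.update_eq_self k A]
    rw [prod_colNormSq_update, prod_colNormSq_update]
    simp only [Function.update_eq_self]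
    field_simp
  rw [wCoeffZero, wCoeffZero, h1, h2, norm_mul, mul_pow, Complex.norm_real, Real.norm_eq_abs,
    sq_abs]
  set q := colNormSq (M j * A k) / colNormSq (A k)
  by_cases hq : q = 0
  · simp [hq]
  · rw [pow_two q, mul_assoc, mul_div_mul_left _ _ hq, mul_div_assoc]

end QubitSpace

/-! ### Coefficient vectors of W-class states -/

namespace QubitSpace

variable {N : ℕ}

theorem star_unitary {U : QubitOp} (hU : U ∈ Matrix.unitaryGroup (Fin 2) ℂ) :
    star U ∈ Matrix.unitaryGroup (Fin 2) ℂ := by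
  rw [Matrix.mem_unitaryGroup_iff, star_star]
  exact Matrix.mem_unitaryGroup_iff'.1 hU

theorem applyAll_star_applyAll {U : Fin N → QubitOp}
    (hU : ∀ i, U i ∈ Matrix.unitaryGroup (Fin 2) ℂ) (ψ : QubitSpace N) :
    applyAll (fun i => star (U i)) (applyAll U ψ) = ψ := by
  rw [applyAll_applyAll]
  simp only [Matrix.mem_unitaryGroup_iff'.1 (hU _)]
  exact applyAll_one ψ

/-- The W state is not annihilated by a nonzero functional on a single qubit. -/
theorem row_eq_zero_of_applyAt_stateW (hN : 2 ≤ N) (i : Fin N) {B : QubitOp}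
    (h : applyAt i B (stateW N) = 0) : B 1 0 = 0 ∧ B 1 1 = 0 := by
  have hs : (((1 / √(N : ℝ) : ℝ)) : ℂ) ≠ 0 := by
    have : (0 : ℝ) < N := by exact_mod_cast (by omega : 0 < N)
    exact_mod_cast (by positivity : 1 / √(N : ℝ) ≠ 0)
  have : Nontrivial (Fin N) := Fin.nontrivial_iff_two_le.2 hN
  obtain ⟨l, hl⟩ := exists_ne i
  rw [stateW_eq_wVector] at h
  have hb : ∀ b, applyAt i B (wVector 0 fun _ => (((1 / √(N : ℝ) : ℝ)) : ℂ)) b = 0 := fun b => by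
    rw [h]; rfl
  constructor
  · have h1 := hb (Function.update (Pi.single l 1) i 1)
    rw [applyAt_apply, Fin.sum_univ_two, Function.update_self, Function.update_idem,
      Function.update_idem, Function.update_eq_self_iff.2 (Pi.single_eq_of_ne hl.symm _).symm,
      wVector_single, wVector_eq_zero_of_ne _ _ _ hl (by simp [hl]) (by simp), mul_zero,
      add_zero] at h1
    exact (mul_eq_zero.1 h1).resolve_right hs
  · have h1 := hb (Pi.single i 1)
    have e0 : Function.update (Pi.single i 1 : Fin N → Fin 2) i 0 = 0 := by
      rw [Pi.single, Function.update_idem]; simp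
    have e1 : Function.update (Pi.single i 1 : Fin N → Fin 2) i 1 = Pi.single i 1 := by
      simp
    rw [applyAt_apply, Fin.sum_univ_two, Pi.single_eq_same, e0, e1, wVector_zero, wVector_single,
      mul_zero, zero_add] at h1
    exact (mul_eq_zero.1 h1).resolve_right hs

/-- If `x i = 0`, the projection onto `|1⟩` at party `i` kills the canonical state. Undoing the
invertible operators of the other parties, a row of an invertible matrix would annihilate the W
state at qubit `i`. -/
theorem IsWClass.coeff_pos (hN : 2 ≤ N) {Ψ : QubitSpace N} {x : Fin N → ℝ} (hΨ : IsWClass Ψ)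
    (hx : IsCoeffVector Ψ x) (i : Fin N) : 0 < x i := by
  obtain ⟨-, A, hA, hΨA⟩ := hΨ
  obtain ⟨hx0, -, V, hV, hΨV⟩ := hx
  refine lt_of_le_of_ne (hx0 i) fun h0 => ?_
  have hcan : canonicalState x = applyAll (fun j => star (V j) * A j) (stateW N) := by
    rw [← applyAll_applyAll, ← hΨA, hΨV, applyAll_star_applyAll hV]
  have hC : ∀ j, IsUnit (star (V j) * A j) := fun j =>
    (Unitary.isUnit_coe (U := ⟨star (V j), star_unitary (hV j)⟩)).mul (hA j)
  set C := fun j => star (V j) * A j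
  have hz : applyAt i !![0, 0; 0, 1] (canonicalState x) = 0 := by
    rw [canonicalState_eq_wVector, applyAt_wVector, ← h0]
    have : (fun j => (if j = i then (1 : ℂ) else 0) * ((√(x j) : ℝ) : ℂ)) = 0 := by
      ext j
      by_cases hj : j = i
      · subst hj; simp [← h0]
      · simp [hj]
    rw [this]
    simp [wVector]
  rw [hcan, applyAt_applyAll] at hz
  have hz2 : applyAt i (!![0, 0; 0, 1] * C i) (stateW N) = 0 := by
    have h1 := congrArg (applyAll (Function.update (fun j => (C j)⁻¹) i 1)) hz
    rw [applyAll_applyAll] at h1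
    have h2 : applyAll (Function.update (fun j => (C j)⁻¹) i 1) (0 : QubitSpace N) = 0 := by
      simpa using applyAll_smul (Function.update (fun j => (C j)⁻¹) i 1) 0 (0 : QubitSpace N)
    rw [h2] at h1
    rw [applyAt_eq_applyAll, ← h1]
    congr 1
    ext1 j
    by_cases hj : j = i
    · subst hj; simp
    · simp only [Function.update_of_ne hj]
      exact (Matrix.nonsing_inv_mul _ ((Matrix.isUnit_iff_isUnit_det _).1 (hC j))).symm
  obtain ⟨h10, h11⟩ := row_eq_zero_of_applyAt_stateW hN i hz2
  have hdet := ((Matrix.isUnit_iff_isUnit_det _).1 (hC i)).ne_zero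
  refine hdet ?_
  simp [Matrix.mul_apply, Fin.sum_univ_two] at h10 h11
  change (C i).det = 0
  rw [Matrix.det_fin_two, h10, h11]
  simp

theorem IsCoeffVector.wCoeff_eq (hN : 3 ≤ N) {Φ : QubitSpace N} {y : Fin N → ℝ}
    (hy : IsCoeffVector Φ y) (hpos : ∀ i, 0 < y i) {A : Fin N → QubitOp} {c : ℂ} (hc : c ≠ 0)
    (h : applyAll A (wSum N) = c • Φ) :
    (∀ i, wCoeff A i = ‖c‖ ^ 2 * y i) ∧ wCoeffZero A = ‖c‖ ^ 2 * coeffZero y := by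
  obtain ⟨-, hy0, U, hU, rfl⟩ := hy
  have h1 : applyAll (fun i => star (U i) * A i) (wSum N) =
      wVector (c * ((√(coeffZero y) : ℝ) : ℂ)) fun i => c * ((√(y i) : ℝ) : ℂ) := by
    rw [← applyAll_applyAll, h, applyAll_smul, applyAll_star_applyAll hU,
      canonicalState_eq_wVector, smul_wVector]
  have h2 := wCoeff_of_applyAll_wSum_eq hN _
    (fun i => mul_ne_zero hc (by exact_mod_cast (Real.sqrt_pos.2 (hpos i)).ne')) h1
  rw [wCoeff_unitary_mul (fun i => star_unitary (hU i)),
    wCoeffZero_unitary_mul (fun i => star_unitary (hU i))] at h2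
  simpa [mul_pow, hy0, (hpos _).le] using h2

theorem IsCoeffVector.exists_applyAll_wSum_eq (k : Fin N) {Ψ : QubitSpace N} {x : Fin N → ℝ}
    (hx : IsCoeffVector Ψ x) (hpos : ∀ i, 0 < x i) :
    ∃ A : Fin N → QubitOp, Ψ = applyAll A (wSum N) ∧ (∀ i, wCoeff A i = x i) ∧
      wCoeffZero A = coeffZero x ∧ ∀ i, (A i).det ≠ 0 := by
  obtain ⟨hx0, hx0', V, hV, rfl⟩ := hx
  obtain ⟨B, hB, hBi, hB0, hBd⟩ := exists_applyAll_wSum_eq_canonicalState k hx0 hx0'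
  refine ⟨fun i => V i * B i, by rw [hB, applyAll_applyAll], ?_, ?_, fun i => ?_⟩
  · rwa [wCoeff_unitary_mul hV]
  · rwa [wCoeffZero_unitary_mul hV]
  · have hd := ((Matrix.isUnit_iff_isUnit_det _).1
      (Unitary.isUnit_coe (U := (⟨V i, hV i⟩ : Matrix.unitaryGroup (Fin 2) ℂ)))).ne_zero
    rw [Matrix.det_mul, hBd]
    exact mul_ne_zero hd (by exact_mod_cast (Real.sqrt_pos.2 (hpos i)).ne')

end QubitSpace

/-! ### Monotones along a protocol tree -/

namespace LOCCProtocol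

variable {N : ℕ} {Φ : QubitSpace N} {y : Fin N → ℝ}

/-- The quantity `wCoeff A i` decreases on average, and at a leaf holding `c • Φ` with `c ≠ 0` it
equals `‖c‖ ^ 2 * y i`, the branch probability times `y i`. -/
theorem successProb_mul_le_wCoeff (hN : 3 ≤ N) (hΦ : ‖Φ‖ = 1) (hy : IsCoeffVector Φ y)
    (hpos : ∀ i, 0 < y i) (i : Fin N) (P : LOCCProtocol N) (A : Fin N → QubitOp) :
    P.successProb Φ (applyAll A (wSum N)) * y i ≤ wCoeff A i := by
  induction P generalizing A with
  | halt =>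
    rw [successProb]
    split_ifs with h
    · obtain ⟨c, hc⟩ := h
      by_cases hc0 : c = 0
      · rw [hc, hc0]; simpa using wCoeff_nonneg A i
      · rw [(hy.wCoeff_eq hN hpos hc0 hc).1, hc, norm_smul, hΦ, mul_one]
    · simpa using wCoeff_nonneg A i
  | measure k m M hM next ih =>
    rw [successProb, Finset.sum_mul]
    refine le_trans (Finset.sum_le_sum fun j _ => ?_) (sum_wCoeff_le A k hM i)
    rw [applyAt_applyAll]
    exact ih j _

theorem det_ne_zero_of_successProb_pos (hN : 3 ≤ N) (hΦ : ‖Φ‖ = 1) (hy : IsCoeffVector Φ y)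
    (hpos : ∀ i, 0 < y i) {P : LOCCProtocol N} {A : Fin N → QubitOp}
    (h : 0 < P.successProb Φ (applyAll A (wSum N))) (i : Fin N) : (A i).det ≠ 0 := by
  intro h0
  have := successProb_mul_le_wCoeff hN hΦ hy hpos i P A
  rw [wCoeff_eq_zero h0] at this
  exact (mul_pos h (hpos i)).not_ge this

/-- If a protocol attains the bound given by party `i`, then the ratio at `|00⋯0⟩` is at most the
ratio at every other party. -/
theorem wCoeffZero_mul_le_of_successProb_mul_eq (hN : 3 ≤ N) (hΦ : ‖Φ‖ = 1)
    (hy : IsCoeffVector Φ y) (hpos : ∀ i, 0 < y i) {i l : Fin N} (hli : l ≠ i)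
    (P : LOCCProtocol N) (A : Fin N → QubitOp) (hA : ∀ k, (A k).det ≠ 0)
    (h : P.successProb Φ (applyAll A (wSum N)) * y i = wCoeff A i) :
    wCoeffZero A * y l ≤ coeffZero y * wCoeff A l := by
  induction P generalizing A with
  | halt =>
    have hp := wCoeff_pos hA i
    rw [← h, successProb] at hp
    split_ifs at hp with hex
    · obtain ⟨c, hc⟩ := hex
      have hc0 : c ≠ 0 := by
        rintro rfl
        rw [hc] at hp
        simp at hp
      rw [(hy.wCoeff_eq hN hpos hc0 hc).1, (hy.wCoeff_eq hN hpos hc0 hc).2]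
      exact le_of_eq (by ring)
    · simp at hp
  | measure k m M hM next ih =>
    have hp := wCoeff_pos hA i
    rw [successProb, Finset.sum_mul] at h
    simp only [applyAt_applyAll] at h
    have hle : ∀ j ∈ Finset.univ,
        (next j).successProb Φ (applyAll (Function.update A k (M j * A k)) (wSum N)) * y i ≤
          wCoeff (Function.update A k (M j * A k)) i := fun j _ =>
      successProb_mul_le_wCoeff hN hΦ hy hpos i _ _
    -- The attained bound squeezes both inequalities: the coefficient is preserved on average, and
    -- each branch attains its own bound.
    have hsum : ∑ j, wCoeff (Function.update A k (M j * A k)) i = wCoeff A i :=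
      le_antisymm (sum_wCoeff_le A k hM i) (h ▸ Finset.sum_le_sum hle)
    have heq := (Finset.sum_eq_sum_iff_of_le hle).1 (h.trans hsum.symm)
    have hdet : ∀ j, 0 < wCoeff (Function.update A k (M j * A k)) i →
        ∀ k', (Function.update A k (M j * A k) k').det ≠ 0 := by
      intro j hj
      rw [← heq j (Finset.mem_univ j)] at hj
      exact det_ne_zero_of_successProb_pos hN hΦ hy hpos (pos_of_mul_pos_left hj (hpos i).le)
    have ih' : ∀ j, 0 < wCoeff (Function.update A k (M j * A k)) i →
        wCoeffZero (Function.update A k (M j * A k)) * y l ≤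
          coeffZero y * wCoeff (Function.update A k (M j * A k)) l := fun j hj =>
      ih j _ (hdet j hj) (heq j (Finset.mem_univ j))
    by_cases hki : k = i
    · subst hki
      have hP : 0 < ∏ j ∈ Finset.univ.erase k, colNormSq (A j) :=
        Finset.prod_pos fun j _ => colNormSq_pos (hA j)
      have hd : ∑ j, colDistSq (M j * A k) = colDistSq (A k) := by
        simp only [wCoeff_update_self, ← Finset.mul_sum] at hsum
        exact mul_left_cancel₀ hP.ne' hsum
      -- One live outcome suffices: both sides of the claim are rescaled by the same factor, which
      -- cancels.
      obtain ⟨j, -, hj⟩ : ∃ j ∈ Finset.univ, 0 < wCoeff (Function.update A k (M j * A k)) k := by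
        by_contra! hno
        exact (hsum ▸ hp).not_ge (Finset.sum_nonpos hno)
      have hnk := colNormSq_pos (hA k)
      have hnj : 0 < colNormSq (M j * A k) := by
        have := hdet j hj k
        rw [Function.update_self] at this
        exact colNormSq_pos this
      have hl : wCoeff (Function.update A k (M j * A k)) l =
          colNormSq (M j * A k) / colNormSq (A k) * wCoeff A l := by
        conv_rhs => rw [← Function.update_eq_self k A]
        rw [wCoeff_update_of_ne A hli, wCoeff_update_of_ne A hli]
        simp only [Function.update_eq_self]
        field_simp
      have := ih' j hj
      rw [wCoeffZero_update_of_sum_colDistSq_eq A k hM hnk hd j, hl, mul_assoc,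
        mul_left_comm (coeffZero y)] at this
      exact le_of_mul_le_mul_left this (div_pos hnj hnk)
    · have hik : i ≠ k := Ne.symm hki
      have hy0 : 0 ≤ coeffZero y := hy.2.1
      -- When another party measures, the inequality is summed over outcomes. Those with a vanishing
      -- first column are dead, but there `wCoeffZero` is a division by zero, hence `0`.
      have hall : ∀ j, wCoeffZero (Function.update A k (M j * A k)) * y l ≤
          coeffZero y * wCoeff (Function.update A k (M j * A k)) l := by
        intro j
        rcases (colNormSq_nonneg (M j * A k)).eq_or_lt with h0 | h0
        · have : wCoeffZero (Function.update A k (M j * A k)) = 0 := by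
            rw [wCoeffZero, prod_colNormSq_update, ← h0]
            simp
          rw [this, zero_mul]
          exact mul_nonneg hy0 (wCoeff_nonneg _ _)
        · refine ih' j ?_
          rw [wCoeff_update_of_ne A hik]
          exact mul_pos h0 (mul_pos (Finset.prod_pos fun j _ => colNormSq_pos (hA j))
            (colDistSq_pos (hA i)))
      calc wCoeffZero A * y l
          ≤ (∑ j, wCoeffZero (Function.update A k (M j * A k))) * y l :=
            mul_le_mul_of_nonneg_right (wCoeffZero_le_sum A k hM) (hpos l).le
        _ ≤ coeffZero y * ∑ j, wCoeff (Function.update A k (M j * A k)) l := by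
            rw [Finset.sum_mul, Finset.mul_sum]
            exact Finset.sum_le_sum fun j _ => hall j
        _ ≤ coeffZero y * wCoeff A l :=
            mul_le_mul_of_nonneg_left (sum_wCoeff_le A k hM l) hy0

end LOCCProtocol

/-! ### Assembly of the theorem -/

/-- For `y₀ = 0` the conventions `0 / 0 = 0` and `a / 0 = ∞` otherwise are exactly what makes the
left side mean `x₀ ≤ 0`. -/
theorem ratioZero_le_ofReal_iff {N : ℕ} {x y : Fin N → ℝ} (hy : 0 ≤ coeffZero y) {r : ℝ}
    (hr : 0 ≤ r) :
    ratioZero x y ≤ ENNReal.ofReal r ↔ coeffZero x ≤ r * coeffZero y := by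
  rw [ratioZero]
  rcases hy.eq_or_lt with h0 | h0
  · rw [← h0, mul_zero, ENNReal.ofReal_zero]
    rcases le_or_gt (coeffZero x) 0 with hx | hx
    · simp [hx, ENNReal.ofReal_of_nonpos hx]
    · rw [ENNReal.div_zero (by simpa using hx)]
      simp [hx]
  · rw [ENNReal.div_le_iff (by simpa using h0) ENNReal.ofReal_ne_top, ← ENNReal.ofReal_mul hr,
      ENNReal.ofReal_le_ofReal_iff (by positivity)]

theorem achieves_of_isCoeffVector {N : ℕ} {Ψ Φ : QubitSpace N} {x y : Fin N → ℝ}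
    (hΦ : ‖Φ‖ = 1) (hx : IsCoeffVector Ψ x) (hy : IsCoeffVector Φ y) {q : ℝ} (k : Fin N)
    (hq0 : 0 ≤ q) (hq1 : q ≤ 1) (hle : ∀ i, q * y i ≤ x i)
    (hor : coeffZero x ≤ q * coeffZero y ∨
      (q * y k = x k ∧ ∀ i ≠ k, coeffZero x * y i ≤ coeffZero y * x i)) :
    Achieves Φ q Ψ := by
  obtain ⟨hx0, hx0', V, hV, rfl⟩ := hx
  obtain ⟨hy0, hy0', U, hU, hΦU⟩ := hy
  refine .of_applyAll_unitary (fun i => star_unitary (hV i)) ?_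
  rw [applyAll_star_applyAll hV]
  refine achieves_sqrtVector_smul k hx0' hy0' hy0 (by simp [coeffZero]) (by simp [coeffZero])
    hq0 hq1 hle hor (.of_applyAll_unitary hU ?_)
  rw [← smul_sqrtVector hq0, applyAll_smul]
  change Achieves Φ q (_ • applyAll U (canonicalState y))
  rw [← hΦU]
  have := Achieves.smul_self hΦ ((√q : ℝ) : ℂ)
  rwa [Complex.norm_real, Real.norm_eq_abs, sq_abs, Real.sq_sqrt hq0] at this

end

theorem theorem1 (N : ℕ) (hN : 3 ≤ N) (Ψ Φ : QubitSpace N) (x y : Fin N → ℝ)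
    (hΨ : QubitSpace.IsWClass Ψ) (hΦ : QubitSpace.IsWClass Φ)
    (hx : QubitSpace.IsCoeffVector Ψ x) (hy : QubitSpace.IsCoeffVector Φ y)
    (r : Fin N → ℝ) (hr : ∀ i, r i = x i / y i) (hmono : Monotone r) :
    min 1 (r ⟨0, by omega⟩) ∈ upperBounds (conversionProbs Ψ Φ) ∧
      (IsGreatest (conversionProbs Ψ Φ) (min 1 (r ⟨0, by omega⟩)) ↔
        ratioZero x y ≤ ENNReal.ofReal (r ⟨1, by omega⟩)) := by
  have hxpos := hΨ.coeff_pos (by omega) hx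
  have hypos := hΦ.coeff_pos (by omega) hy
  have hy0 : 0 ≤ QubitSpace.coeffZero y := hy.2.1
  have hrpos : ∀ i, 0 < r i := fun i => by rw [hr]; exact div_pos (hxpos i) (hypos i)
  have hrx : ∀ i, r i * y i = x i := fun i => by
    rw [hr, div_mul_cancel₀ _ (hypos i).ne']
  set k : Fin N := ⟨0, by omega⟩ with hk
  set l : Fin N := ⟨1, by omega⟩ with hl
  have hlk : l ≠ k := by simp [hk, hl]
  have hkmin : ∀ i, r k ≤ r i := fun i => hmono (Fin.mk_le_of_le_val (Nat.zero_le _))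
  have hlmin : ∀ i ≠ k, r l ≤ r i := fun i hi => hmono <| by
    rw [Fin.le_def]
    have : i.val ≠ 0 := fun h => hi (Fin.ext h)
    change 1 ≤ i.val
    omega
  obtain ⟨A, rfl, hAi, hA0, hAdet⟩ := hx.exists_applyAll_wSum_eq k hxpos
  have hbound : min 1 (r k) ∈
      upperBounds (conversionProbs (QubitSpace.applyAll A (QubitSpace.wSum N)) Φ) := by
    rintro _ ⟨P, rfl⟩
    refine le_min ?_ ?_
    · simpa [hΨ.1] using P.successProb_le_norm_sq Φ (QubitSpace.applyAll A (QubitSpace.wSum N))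
    · rw [hr, le_div_iff₀ (hypos k), ← hAi]
      exact P.successProb_mul_le_wCoeff hN hΦ.1 hy hypos k A
  -- If all ratios are at least `1`, normalization forces `x₀ ≤ y₀`; the condition on `r₀` then
  -- holds automatically and conversion is certain.
  have hone : 1 ≤ r k → QubitSpace.coeffZero x ≤ QubitSpace.coeffZero y := fun h => by
    refine sub_le_sub_left (Finset.sum_le_sum fun i _ => ?_) 1
    rw [← hrx i]
    exact le_mul_of_one_le_left (hypos i).le (h.trans (hkmin i))
  refine ⟨hbound, ?_⟩
  rw [ratioZero_le_ofReal_iff hy0 (hrpos l).le]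
  constructor
  · rintro ⟨⟨P, hP⟩, -⟩
    rcases le_or_gt 1 (r k) with h1 | h1
    · exact (hone h1).trans (le_mul_of_one_le_left hy0 (h1.trans (hkmin l)))
    · rw [min_eq_right h1.le] at hP
      have := P.wCoeffZero_mul_le_of_successProb_mul_eq hN hΦ.1 hy hypos hlk A hAdet
        (by rw [hP, hrx, hAi])
      rw [hA0, hAi, ← hrx l] at this
      refine le_of_mul_le_mul_right (this.trans (le_of_eq ?_)) (hypos l)
      ring
  · intro h
    refine ⟨?_, hbound⟩
    have hle : ∀ i, min 1 (r k) * y i ≤ x i := fun i => by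
      rw [← hrx i]
      exact mul_le_mul_of_nonneg_right ((min_le_right _ _).trans (hkmin i)) (hypos i).le
    obtain ⟨P, hP⟩ := achieves_of_isCoeffVector hΦ.1 hx hy k
      (le_min zero_le_one (hrpos k).le) (min_le_left _ _) hle <| by
        rcases le_or_gt 1 (r k) with h1 | h1
        · left
          rw [min_eq_left h1, one_mul]
          exact hone h1
        · right
          rw [min_eq_right h1.le]
          refine ⟨hrx k, fun i hi => ?_⟩
          rw [← hrx i, ← mul_assoc]
          refine mul_le_mul_of_nonneg_right ?_ (hypos i).le
          rw [mul_comm]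
          exact h.trans (mul_le_mul_of_nonneg_right (hlmin i hi) hy0)
    exact ⟨P, le_antisymm (hbound ⟨P, rfl⟩) hP⟩
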